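/- **Setting.** $M\ge 1$ agents communicate over a fixed connected undirected graph with Laplacian matrix $\mathcal L$ and maximal degree $d_{\max}$. Let $\kappa\in(0,1]$ and $P=I_M-\frac{\kappa}{d_{\max}}\mathcal L$ ($P=1$ if $M=1$). Let $\lambda_1\ge\lambda_2\ge\dots\ge\lambda_M$ be the eigenvalues of $P$, with any orthonormal eigenvectors $\mathbf u_1,\dots,\mathbf u_M$, $\mathbf u_p=(u_p^d)_{d=1}^M$; assume $\lambda_M>-1$. Put $$\epsilon_n=\sqrt M\sum_{p=2}^M\frac{|\lambda_p|}{1-|\lambda_p|},\qquad \epsilon_c^k=M\sum_{p=1}^M\sum_{j=2}^M\frac{|\lambda_p\lambda_j|}{1-|\lambda_p\lambda_j|}\,a_{pj}(k),$$ where, with $\nu^+_{pj}=\sum_{d:\,u_p^du_j^d\ge0}u_p^du_j^d$ and $\nu^-_{pj}=\sum_{d:\,u_p^du_j^d\le0}u_p^du_j^d$, $a_{pj}(k)$ equals $\nu^+_{pj}u_p^ku_j^k$ if $\lambda_p\lambda_j\ge0$ and $u_p^ku_j^k\ge0$; $\nu^-_{pj}u_p^ku_j^k$ if $\lambda_p\lambda_j\ge0$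 and $u_p^ku_j^k<0$; and $\max\{|\nu^-_{pj}|,\nu^+_{pj}\}\,|u_p^ku_j^k|$ if $\lambda_p\lambda_j<0$. There are $N$ arms. The reward $r_i^k(t)$ at arm $i$ for agent $k$ at time $t$ has a distribution $p_i$ with mean $m_i$ that is sub-Gaussian with parameter $\sigma_g>0$: $\ln\mathbb E[e^{\beta r_i^k(t)}]\le m_i\beta+\sigma_g^2\beta^2/2$ for all $\beta\in\mathbb R$. The reward vectors $(r_i^k(t))_{i}$ are independent over agents $k$ and times $t$. At each time $t=1,2,\dots$ each agent $k$ selects an arm $i^k(t)$ and (unconstrained model) receives $r^k_{i^k(t)}(t)$, whatever the other agents do. The running consensus estimates are $\hat{\mathbf n}_i(0)=\hat{\mathbf s}_i(0)=0$, $\hat{\mathbf n}_i(t)=P(\hat{\mathbf n}_i(t-1)+\boldsymbol\xi_i(t))$ and $\hat{\mathbf s}_i(t)=P(\hat{\mathbf s}_i(t-1)+\mathbf r_i(t))$, where $\boldsymbol\xi_i(t)$ and $\mathbf r_i(t)$ have the entries $\mathbb 1\{i^k(t)=i\}$ and $r_i^k(t)\mathbb 1\{i^k(t)=i\}$, $k=1,\dots,M$.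 **Algorithm (coop-UCB2).** Let $\gamma>1$, $\eta\in(0,4)$, $G(\eta)=1-\eta^2/16$, and let $f:[1,\infty)\to[0,\infty)$ be nondecreasing with $f(t)/\ln t\to0$ as $t\to\infty$. At the times $t=1,\dots,N$ every agent selects arm $t$. At every time $t>N$ each agent $k$ selects an arm $i$ that maximizes $$Q_i^k(t-1)=\frac{\hat s_i^k(t-1)}{\hat n_i^k(t-1)}+\sigma_g\sqrt{\frac{2\gamma}{G(\eta)}\cdot\frac{\hat n_i^k(t-1)+f(t-1)}{M\hat n_i^k(t-1)}\cdot\frac{\ln(t-1)}{\hat n_i^k(t-1)}}\,,$$ ties being broken by any rule that depends only on rewards at times before $t$. **Regret and constant.** Let $\Delta_i=\max_jm_j-m_i$ and let $R(T)=MT\max_jm_j-\mathbb E\big[\sum_{t=1}^T\sum_{k=1}^Mm_{i^k(t)}\big]$ be the expected cumulative group regret. Assume that $f$ reaches the level $\epsilon_c^k$ for every $k$, and let $t_k^\dagger=\inf\{t\ge1: f(t)\ge\epsilon_c^k\}$ (so $t_k^\dagger=f^{-1}(\epsilon_c^k)$ when $f$ is strictly increasing and takes this value on $[1,\infty)$).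 Put $$L=\sum_{k=1}^M(t_k^\dagger-1)+M(1+\epsilon_n)+1+\frac{2M}{\ln(1+\eta)}\left(\frac1{(\gamma-1)^2}+\frac{\gamma\ln\big((1+\epsilon_n)(1+\eta)\big)}{\gamma-1}+1\right),$$ which does not depend on $T$. **Claim.** For every $T\ge1$, $$R(T)\le\sum_{i:\,\Delta_i>0}\frac{4\sigma_g^2\gamma\ln T}{\Delta_iG(\eta)}\left(1+\sqrt{1+\frac{\Delta_i^2MG(\eta)}{2\gamma\sigma_g^2}\,\frac{f(T)}{\ln T}}\right)+\sum_{i=1}^NL\,\Delta_i$$ (for $T=1$ the first sum is read as its limit value $0$). Consequently $R(T)=O(\ln T)$ as $T\to\infty$, with a leading coefficient that does not depend on the graph: for every $\delta>0$ and all sufficiently large $T$, $$R(T)\le\Big(\sum_{i:\,\Delta_i>0}\frac{8\sigma_g^2\gamma}{\Delta_iG(\eta)}+\delta\Big)\ln T .$$ -/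

import Mathlib

open MeasureTheory ProbabilityTheory Filter Asymptotics
open scoped Topology Matrix

namespace CoopUCB

/-! ### Communication graph and consensus matrix -/

/-- The consensus matrix `P = I - (κ / d_max) L`, where `L` is the graph Laplacian.
(For a single agent `L = 0`, so `P = I`.) -/
noncomputable def consensusMatrix {M : ℕ} (G : SimpleGraph (Fin M)) [DecidableRel G.Adj] (κ : ℝ) :
    Matrix (Fin M) (Fin M) ℝ :=
  1 - (κ / (G.maxDegree : ℝ)) • G.lapMatrix ℝ

/-- `lam 0 ≥ lam 1 ≥ …` are the eigenvalues of `P`, listed with multiplicity, and `u 0, u 1, …` is an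
orthonormal basis of corresponding eigenvectors; `u p d` is the `d`-th entry of `u p`. -/
structure IsOrderedEigenbasis {M : ℕ} (P : Matrix (Fin M) (Fin M) ℝ)
    (lam : Fin M → ℝ) (u : Fin M → Fin M → ℝ) : Prop where
  antitone : Antitone lam
  eigen : ∀ p, P *ᵥ u p = lam p • u p
  orthonormal : ∀ p j, u p ⬝ᵥ u j = if p = j then 1 else 0

/-- The graph explore-exploit index `ε_n = √M ∑_{p ≥ 2} |λ_p| / (1 - |λ_p|)`
(indices here start at `0`). -/
noncomputable def epsN {M : ℕ} (lam : Fin M → ℝ) : ℝ :=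
  √(M : ℝ) * ∑ p : Fin M with 0 < p.val, |lam p| / (1 - |lam p|)

/-- The sum of the nonnegative products `u_p^d u_j^d`. -/
noncomputable def nuPos {M : ℕ} (u : Fin M → Fin M → ℝ) (p j : Fin M) : ℝ :=
  ∑ d : Fin M with 0 ≤ u p d * u j d, u p d * u j d

/-- The sum of the nonpositive products `u_p^d u_j^d`. -/
noncomputable def nuNeg {M : ℕ} (u : Fin M → Fin M → ℝ) (p j : Fin M) : ℝ :=
  ∑ d : Fin M with u p d * u j d ≤ 0, u p d * u j d

/-- The coefficients `a_{pj}(k)`. -/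
noncomputable def aCoef {M : ℕ} (lam : Fin M → ℝ) (u : Fin M → Fin M → ℝ) (k p j : Fin M) : ℝ :=
  if 0 ≤ lam p * lam j then
    if 0 ≤ u p k * u j k then nuPos u p j * (u p k * u j k) else nuNeg u p j * (u p k * u j k)
  else max |nuNeg u p j| (nuPos u p j) * |u p k * u j k|

/-- The nodal explore-exploit centrality index
`ε_c^k = M ∑_{p ≥ 1} ∑_{j ≥ 2} |λ_p λ_j| / (1 - |λ_p λ_j|) a_{pj}(k)` (indices here start at `0`). -/
noncomputable def epsC {M : ℕ} (lam : Fin M → ℝ) (u : Fin M → Fin M → ℝ) (k : Fin M) : ℝ :=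
  (M : ℝ) * ∑ p : Fin M, ∑ j : Fin M with 0 < j.val,
    |lam p * lam j| / (1 - |lam p * lam j|) * aCoef lam u k p j

/-! ### Rewards -/

/-- The distribution `p` on `ℝ` is sub-Gaussian with parameter `σ`: its cumulant generating function
`φ` is finite and `φ(β) ≤ m β + σ² β² / 2` for all real `β`, where `m` is the mean of `p`. -/
def IsSubGaussian (p : Measure ℝ) (σ : ℝ) : Prop :=
  Integrable id p ∧ ∀ β : ℝ, Integrable (fun x => Real.exp (β * x)) p ∧
    cgf id p β ≤ (∫ x, x ∂p) * β + σ ^ 2 * β ^ 2 / 2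

/-- `r t k i` is the realized reward at arm `i` for agent `k` at time `t`. It has law `p i`, and
rewards of different agents or at different times are independent. (No independence is required
between the rewards of different arms for one agent at one time.) -/
structure IsRewardProcess {M N : ℕ} {Ω : Type*} [MeasurableSpace Ω] (μ : Measure Ω)
    (p : Fin N → Measure ℝ) (r : ℕ → Fin M → Fin N → Ω → ℝ) : Prop where
  measurable : ∀ t k i, Measurable (r t k i)
  law : ∀ t k i, HasLaw (r t k i) (p i) μ
  indep : iIndepFun (fun (q : ℕ × Fin M) (ω : Ω) (i : Fin N) => r q.1 q.2 i ω) μ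

/-- The σ-algebra `𝓕_{t-1}` generated by all rewards at the times `1, …, t - 1`. -/
@[reducible] def pastRewards {M N : ℕ} {Ω : Type*} (r : ℕ → Fin M → Fin N → Ω → ℝ) (t : ℕ) :
    MeasurableSpace Ω :=
  ⨆ s ∈ Set.Ico 1 t, ⨆ (k : Fin M) (i : Fin N), MeasurableSpace.comap (r s k i) inferInstance

/-! ### Cooperative estimation, along one realization
`a t k` is the arm selected by agent `k` at time `t`, and `y t k i` the reward at arm `i`
for agent `k` at time `t`. -/

/-- Running consensus for the number of selections of arm `i`:
`n̂_i(0) = 0` and `n̂_i(t) = P (n̂_i(t-1) + ξ_i(t))`. -/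
noncomputable def nHat {M N : ℕ} (P : Matrix (Fin M) (Fin M) ℝ) (a : ℕ → Fin M → Fin N)
    (i : Fin N) : ℕ → Fin M → ℝ
  | 0 => 0
  | t + 1 => P *ᵥ (nHat P a i t + fun k => if a (t + 1) k = i then 1 else 0)

/-- Running consensus for the total reward at arm `i`:
`ŝ_i(0) = 0` and `ŝ_i(t) = P (ŝ_i(t-1) + r_i(t))`. -/
noncomputable def sHat {M N : ℕ} (P : Matrix (Fin M) (Fin M) ℝ) (a : ℕ → Fin M → Fin N)
    (y : ℕ → Fin M → Fin N → ℝ) (i : Fin N) : ℕ → Fin M → ℝ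
  | 0 => 0
  | t + 1 => P *ᵥ (sHat P a y i t + fun k => if a (t + 1) k = i then y (t + 1) k i else 0)

/-! ### The coop-UCB2 algorithm -/

/-- `G(η) = 1 - η² / 16`. -/
noncomputable def gFun (η : ℝ) : ℝ := 1 - η ^ 2 / 16

/-- The exploration term `C_i^k(t)`, as a function of `n = n̂_i^k(t)`. -/
noncomputable def explore (M : ℕ) (σ γ η : ℝ) (f : ℝ → ℝ) (t : ℕ) (n : ℝ) : ℝ :=
  σ * √(2 * γ / gFun η * ((n + f t) / (M * n)) * (Real.log t / n))

/-- The heuristic `Q_i^k(t) = ŝ_i^k(t) / n̂_i^k(t) + C_i^k(t)`. -/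
noncomputable def qIndex {M N : ℕ} (P : Matrix (Fin M) (Fin M) ℝ) (σ γ η : ℝ) (f : ℝ → ℝ)
    (a : ℕ → Fin M → Fin N) (y : ℕ → Fin M → Fin N → ℝ) (t : ℕ) (k : Fin M) (i : Fin N) : ℝ :=
  sHat P a y i t k / nHat P a i t k + explore M σ γ η f t (nHat P a i t k)

/-- `arm t k` is the arm selected by agent `k` at time `t` when all agents run coop-UCB2: each agent
first samples the arms one after the other, at the times `1, …, N`, and at every time `t + 1 > N` it
selects an arm that maximizes `Q_i^k(t)`. Ties may be broken by any rule that uses only the past. -/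
structure IsCoopUCB2 {M N : ℕ} {Ω : Type*} (P : Matrix (Fin M) (Fin M) ℝ) (σ γ η : ℝ) (f : ℝ → ℝ)
    (r : ℕ → Fin M → Fin N → Ω → ℝ) (arm : ℕ → Fin M → Ω → Fin N) : Prop where
  init : ∀ (i : Fin N) (k : Fin M) (ω : Ω), arm (i.val + 1) k ω = i
  select : ∀ t : ℕ, N ≤ t → ∀ (k : Fin M) (ω : Ω) (i : Fin N),
    qIndex P σ γ η f (fun s j => arm s j ω) (fun s j l => r s j l ω) t k i ≤
      qIndex P σ γ η f (fun s j => arm s j ω) (fun s j l => r s j l ω) t k (arm (t + 1) k ω)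
  previsible : ∀ t : ℕ, 1 ≤ t → ∀ k : Fin M, Measurable[pastRewards r t] (arm t k)

/-! ### Regret and its bound -/

/-- The gap `Δ_i = max_j m_j - m_i`. -/
noncomputable def gap {N : ℕ} (m : Fin N → ℝ) (i : Fin N) : ℝ := (⨆ j, m j) - m i

/-- The expected cumulative group regret until time `T` under the unconstrained reward model,
`M T max_j m_j - 𝔼[∑_{t ≤ T} ∑_k m_{i^k(t)}]`. -/
noncomputable def regretUnc {M N : ℕ} {Ω : Type*} [MeasurableSpace Ω] (μ : Measure Ω)
    (m : Fin N → ℝ) (arm : ℕ → Fin M → Ω → Fin N) (T : ℕ) : ℝ :=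
  (M : ℝ) * T * (⨆ j, m j) - ∫ ω, ∑ t ∈ Finset.Icc 1 T, ∑ k, m (arm t k ω) ∂μ

/-- The first time in `[1, ∞)` at which `f` reaches the level `ε`; it is `f⁻¹(ε)` if `f` is strictly
increasing on `[1, ∞)` and takes the value `ε` there. -/
noncomputable def reachTime (f : ℝ → ℝ) (ε : ℝ) : ℝ := sInf {t : ℝ | 1 ≤ t ∧ ε ≤ f t}

/-- The constant `L(ε_n, ε_c^1, …, ε_c^M)`, with `t_k† = f⁻¹(ε_c^k)`. -/
noncomputable def constL {M : ℕ} (γ η : ℝ) (f : ℝ → ℝ) (εn : ℝ) (εc : Fin M → ℝ) : ℝ :=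
  ∑ k, (reachTime f (εc k) - 1) + M * (1 + εn) + 1
    + 2 * M / Real.log (1 + η) *
      (1 / (γ - 1) ^ 2 + γ * Real.log ((1 + εn) * (1 + η)) / (γ - 1) + 1)

end CoopUCB

namespace CoopUCB

/-! ### Spectral facts about the consensus matrix -/

/-! The regret is the gap-weighted sum of the expected selection counts, so it suffices to count
selections of one suboptimal arm. Along a realization, the selections made while the count is at
most a level `A` contribute at most `A + M`; every later one is charged to the failure of a
confidence bound.

Consensus enters only through the powers of `P`. Their expansion in the eigenbasis has leading entry
`1/M`, and the other modes decay geometrically because connectedness makes the eigenvalue 1 simple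
and `-1` is excluded. Two estimates follow. `selCount_div_sub_epsN_le_nHat`: each agent's estimated
count is at least the true average count minus `ε_n`. `varProxy_le`: the sum of squared weights in
an agent's reward estimate is at most `(n̂ + ε_c^k)/M`, hence at most `W = (n̂ + f)/M` once `f` has
reached `ε_c^k`.

The arm choices depend on past rewards, so the estimation error is not a sum of independent terms.
Its exponential, compensated by the variance proxy, still has expectation at most one
(`lintegral_exp_estimation_error_le_one`). The normalization `√W` is random, so no single
exponential parameter is optimal; peeling over geometric slices of `W`
(`measureReal_self_normalized_le`) costs a factor logarithmic in `t` and the factor `G(η)` in the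
exponent. The exploration term is tuned so that each slice contributes `t^(-γ)`, and the resulting
series converges because `γ > 1`.

Once the count exceeds `selThreshold + M ε_n`, twice the exploration term is at most the gap, so a
further selection forces an overestimate of the chosen arm or an underestimate of an optimal one
(`selected_subset_deviation`). Times at which `f` is still below `ε_c^k` are counted by `t_k† - 1`.
For the asymptotics, `f = o(log)` sends the square root in the threshold to 1. -/

theorem IsOrderedEigenbasis.completeness {M : ℕ} {P : Matrix (Fin M) (Fin M) ℝ}
    {lam : Fin M → ℝ} {u : Fin M → Fin M → ℝ} (h : IsOrderedEigenbasis P lam u) (d e : Fin M) :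
    ∑ p, u p d * u p e = if d = e then 1 else 0 := by
  have h1 : Matrix.of u * (Matrix.of u)ᵀ = 1 := by
    ext p j
    simpa [Matrix.mul_apply, Matrix.one_apply, dotProduct] using h.orthonormal p j
  have h2 : (Matrix.of u)ᵀ * Matrix.of u = 1 := mul_eq_one_comm.mp h1
  replace h2 := congrFun (congrFun h2 d) e
  simpa [Matrix.mul_apply, Matrix.one_apply] using h2

theorem IsOrderedEigenbasis.pow_mulVec {M : ℕ} {P : Matrix (Fin M) (Fin M) ℝ}
    {lam : Fin M → ℝ} {u : Fin M → Fin M → ℝ} (h : IsOrderedEigenbasis P lam u) (τ : ℕ)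
    (p : Fin M) : (P ^ τ) *ᵥ u p = lam p ^ τ • u p := by
  induction τ with
  | zero => simp
  | succ n ih =>
    rw [pow_succ, ← Matrix.mulVec_mulVec, h.eigen, Matrix.mulVec_smul, ih, smul_smul, pow_succ,
      mul_comm]

theorem IsOrderedEigenbasis.pow_apply {M : ℕ} {P : Matrix (Fin M) (Fin M) ℝ}
    {lam : Fin M → ℝ} {u : Fin M → Fin M → ℝ} (h : IsOrderedEigenbasis P lam u) (τ : ℕ)
    (k d : Fin M) : (P ^ τ) k d = ∑ p, lam p ^ τ * (u p k * u p d) := by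
  have h1 : ∀ p, ∑ e, (P ^ τ) k e * u p e = lam p ^ τ * u p k := fun p => by
    simpa [Matrix.mulVec, dotProduct] using congrFun (h.pow_mulVec τ p) k
  calc (P ^ τ) k d = ∑ e, (P ^ τ) k e * ∑ p, u p e * u p d := by
        simp [h.completeness]
    _ = ∑ p, (∑ e, (P ^ τ) k e * u p e) * u p d := by
        simp only [Finset.mul_sum, Finset.sum_mul, mul_assoc]
        exact Finset.sum_comm
    _ = _ := by simp [h1, mul_assoc]

theorem IsOrderedEigenbasis.abs_le_one {M : ℕ} {P : Matrix (Fin M) (Fin M) ℝ}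
    {lam : Fin M → ℝ} {u : Fin M → Fin M → ℝ} (h : IsOrderedEigenbasis P lam u) (p k : Fin M) :
    |u p k| ≤ 1 := by
  have h1 := h.orthonormal p p
  simp only [dotProduct, if_true] at h1
  have h2 : u p k * u p k ≤ ∑ i, u p i * u p i :=
    Finset.single_le_sum (f := fun i => u p i * u p i) (fun i _ => mul_self_nonneg _)
      (Finset.mem_univ k)
  rw [← sq_le_one_iff_abs_le_one]
  nlinarith

theorem consensusMatrix_mulVec {M : ℕ} (G : SimpleGraph (Fin M)) [DecidableRel G.Adj] (κ : ℝ)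
    (v : Fin M → ℝ) :
    consensusMatrix G κ *ᵥ v = v - (κ / (G.maxDegree : ℝ)) • (G.lapMatrix ℝ *ᵥ v) := by
  simp [consensusMatrix, Matrix.sub_mulVec, Matrix.smul_mulVec]

theorem consensusMatrix_mulVec_one {M : ℕ} (G : SimpleGraph (Fin M)) [DecidableRel G.Adj] (κ : ℝ) :
    consensusMatrix G κ *ᵥ (fun _ => 1) = fun _ => 1 := by
  rw [consensusMatrix_mulVec, SimpleGraph.lapMatrix_mulVec_const_eq_zero]
  simp

theorem consensusMatrix_nonneg {M : ℕ} (G : SimpleGraph (Fin M)) [DecidableRel G.Adj] {κ : ℝ}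
    (hκ : κ ∈ Set.Ioc (0 : ℝ) 1) (k d : Fin M) : 0 ≤ consensusMatrix G κ k d := by
  have hc : 0 ≤ κ / (G.maxDegree : ℝ) := div_nonneg hκ.1.le (Nat.cast_nonneg _)
  by_cases hkd : k = d
  · subst hkd
    have h1 : (G.degree k : ℝ) ≤ G.maxDegree := by exact_mod_cast G.degree_le_maxDegree k
    have h2 : κ / (G.maxDegree : ℝ) * G.degree k ≤ 1 := by
      -- An edgeless graph has maximal degree 0; division by zero then makes the coefficient vanish.
      rcases (Nat.cast_nonneg (α := ℝ) G.maxDegree).eq_or_lt with h0 | h0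
      · rw [← h0]; simp
      · rw [div_mul_eq_mul_div, div_le_one h0]
        nlinarith [hκ.1, hκ.2]
    simpa [consensusMatrix, SimpleGraph.lapMatrix, SimpleGraph.degMatrix] using h2
  · have : consensusMatrix G κ k d = κ / (G.maxDegree : ℝ) * (if G.Adj k d then 1 else 0) := by
      simp [consensusMatrix, SimpleGraph.lapMatrix, SimpleGraph.degMatrix, hkd,
        SimpleGraph.adjMatrix_apply]
    rw [this]
    exact mul_nonneg hc (by split_ifs <;> norm_num)

theorem lapMatrix_quadratic_nonneg {M : ℕ} (G : SimpleGraph (Fin M)) [DecidableRel G.Adj]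
    (v : Fin M → ℝ) : 0 ≤ v ⬝ᵥ (G.lapMatrix ℝ *ᵥ v) := by
  have h := SimpleGraph.lapMatrix_toLinearMap₂' ℝ G v
  rw [Matrix.toLinearMap₂'_apply'] at h
  rw [h]
  exact div_nonneg (Finset.sum_nonneg fun i _ => Finset.sum_nonneg fun j _ => by
    split_ifs <;> positivity) (by norm_num)

theorem lam_le_one {M : ℕ} {G : SimpleGraph (Fin M)} [DecidableRel G.Adj] {κ : ℝ}
    (hκ : κ ∈ Set.Ioc (0 : ℝ) 1) {lam : Fin M → ℝ} {u : Fin M → Fin M → ℝ}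
    (h : IsOrderedEigenbasis (consensusMatrix G κ) lam u) (p : Fin M) : lam p ≤ 1 := by
  have h1 := congrArg (fun v => u p ⬝ᵥ v) (h.eigen p)
  simp only [consensusMatrix_mulVec, dotProduct_sub, dotProduct_smul, h.orthonormal p p, if_true,
    smul_eq_mul, mul_one] at h1
  have h2 := mul_nonneg (div_nonneg hκ.1.le (Nat.cast_nonneg (α := ℝ) G.maxDegree))
    (lapMatrix_quadratic_nonneg G (u p))
  linarith

theorem eigenvector_const {M : ℕ} {G : SimpleGraph (Fin M)} [DecidableRel G.Adj]
    (hG : G.Connected) {κ : ℝ}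
    (hκ : κ ∈ Set.Ioc (0 : ℝ) 1) {lam : Fin M → ℝ} {u : Fin M → Fin M → ℝ}
    (h : IsOrderedEigenbasis (consensusMatrix G κ) lam u) {p : Fin M} (hp : lam p = 1)
    (k d : Fin M) : u p k = u p d := by
  by_cases hkd : k = d
  · rw [hkd]
  -- The coefficient of the Laplacian must be nonzero before it can be cancelled; two distinct
  -- vertices of a connected graph guarantee this.
  have hdeg : 0 < G.maxDegree := by
    have : Nontrivial (Fin M) := ⟨k, d, hkd⟩
    exact (hG.preconnected.degree_pos_of_nontrivial k).trans_le (G.degree_le_maxDegree k)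
  have hc : κ / (G.maxDegree : ℝ) ≠ 0 :=
    (div_pos hκ.1 (by exact_mod_cast hdeg)).ne'
  have h1 := h.eigen p
  rw [consensusMatrix_mulVec, hp, one_smul, sub_eq_self] at h1
  have h2 := (smul_eq_zero.mp h1).resolve_left hc
  exact (SimpleGraph.lapMatrix_mulVec_eq_zero_iff_forall_reachable G).mp h2 k d
    (hG.preconnected k d)

/-- If no eigenvalue were 1, symmetry of the Laplacian would make every eigenvector orthogonal to
the constants, contradicting completeness of the basis. So 1 occurs, and it is the largest possible
eigenvalue. -/
theorem lam_first_eq_one {M : ℕ} {G : SimpleGraph (Fin M)} [DecidableRel G.Adj] {κ : ℝ}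
    (hκ : κ ∈ Set.Ioc (0 : ℝ) 1) {lam : Fin M → ℝ} {u : Fin M → Fin M → ℝ}
    (h : IsOrderedEigenbasis (consensusMatrix G κ) lam u) {p : Fin M} (hp : p.val = 0) :
    lam p = 1 := by
  have hex : ∃ j, lam j = 1 := by
    by_contra! hne
    have hdot : ∀ j, ∑ d, u j d = 0 := by
      intro j
      have hsymm : ((fun _ => 1) : Fin M → ℝ) ⬝ᵥ (G.lapMatrix ℝ *ᵥ u j) = 0 := by
        rw [Matrix.dotProduct_mulVec, ← Matrix.mulVec_transpose, SimpleGraph.isSymm_lapMatrix,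
          SimpleGraph.lapMatrix_mulVec_const_eq_zero, zero_dotProduct]
      have h1 := congrArg (fun v => ((fun _ => 1) : Fin M → ℝ) ⬝ᵥ v) (h.eigen j)
      simp only [consensusMatrix_mulVec, dotProduct_sub, dotProduct_smul, hsymm, smul_eq_mul,
        mul_zero, sub_zero] at h1
      have h2 : (1 - lam j) * ∑ d, u j d = 0 := by
        simp only [dotProduct, one_mul] at h1
        linarith
      exact (mul_eq_zero.mp h2).resolve_left (sub_ne_zero.mpr (hne j).symm)
    have h3 : (1 : ℝ) = ∑ d, ∑ j, u j d * u j p := by simp [h.completeness]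
    rw [Finset.sum_comm] at h3
    simp only [← Finset.sum_mul, hdot, zero_mul, Finset.sum_const_zero] at h3
    exact one_ne_zero h3
  obtain ⟨j, hj⟩ := hex
  refine le_antisymm (lam_le_one hκ h p) ?_
  rw [← hj]
  exact h.antitone (Fin.le_def.mpr (by omega))

/-- A constant unit vector has all entries equal to `1/√M` or all equal to `-1/√M`; the product
hides the undetermined sign. -/
theorem first_eigenvector_mul {M : ℕ} {G : SimpleGraph (Fin M)} [DecidableRel G.Adj]
    (hG : G.Connected) {κ : ℝ}
    (hκ : κ ∈ Set.Ioc (0 : ℝ) 1) {lam : Fin M → ℝ} {u : Fin M → Fin M → ℝ}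
    (h : IsOrderedEigenbasis (consensusMatrix G κ) lam u) {p : Fin M} (hp : p.val = 0)
    (k d : Fin M) : u p k * u p d = 1 / M := by
  have hconst := eigenvector_const hG hκ h (lam_first_eq_one hκ h hp)
  have h1 := h.orthonormal p p
  simp only [dotProduct, if_true] at h1
  rw [Finset.sum_congr rfl fun i _ => by rw [hconst i k]] at h1
  rw [hconst d k]
  have hM : (M : ℝ) ≠ 0 := by
    have := k.pos
    positivity
  field_simp
  simpa [sq, mul_comm] using h1

/-- A second eigenvector for the eigenvalue 1 would also be constant, and two nonzero constant
vectors are never orthogonal. -/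
theorem abs_lam_lt_one {M : ℕ} {G : SimpleGraph (Fin M)} [DecidableRel G.Adj]
    (hG : G.Connected) {κ : ℝ}
    (hκ : κ ∈ Set.Ioc (0 : ℝ) 1) {lam : Fin M → ℝ} {u : Fin M → Fin M → ℝ}
    (h : IsOrderedEigenbasis (consensusMatrix G κ) lam u) (hgt : ∀ p, -1 < lam p) {p : Fin M}
    (hp : 0 < p.val) : |lam p| < 1 := by
  refine abs_lt.mpr ⟨hgt p, lt_of_le_of_ne (lam_le_one hκ h p) fun h1 => ?_⟩
  let z : Fin M := ⟨0, p.pos⟩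
  have hz := eigenvector_const hG hκ h (lam_first_eq_one hκ h (p := z) rfl)
  have hc := eigenvector_const hG hκ h h1
  have h2 := h.orthonormal z p
  rw [if_neg (fun e => by rw [← e] at hp; exact absurd hp (lt_irrefl _))] at h2
  simp only [dotProduct] at h2
  rw [Finset.sum_congr rfl fun i _ => by rw [hz i z, hc i z]] at h2
  have hM : (M : ℝ) ≠ 0 := by
    have := p.pos
    positivity
  simp only [Finset.sum_const, Finset.card_univ, Fintype.card_fin, nsmul_eq_mul, mul_eq_zero, hM,
    false_or] at h2
  have hself : ∀ q, (∀ i j, u q i = u q j) → u q z ≠ 0 := fun q hq h0 => by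
    have h3 := h.orthonormal q q
    simp [dotProduct, fun i => (hq i z).trans h0] at h3
  exact h2.elim (hself z hz) (hself p hc)

/-! ### Elementary bounds for the running consensus -/

theorem mulVec_const {M : ℕ} {P : Matrix (Fin M) (Fin M) ℝ}
    (h1 : P *ᵥ (fun _ => 1) = fun _ => 1) (c : ℝ) (k : Fin M) : (P *ᵥ fun _ => c) k = c := by
  have := congrFun (Matrix.mulVec_smul P c (fun _ => 1)) k
  rw [h1] at this
  simpa [Pi.smul_def] using this

theorem le_mulVec {M : ℕ} {P : Matrix (Fin M) (Fin M) ℝ} (hP : ∀ k d, 0 ≤ P k d)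
    (h1 : P *ᵥ (fun _ => 1) = fun _ => 1) {c : ℝ} {v : Fin M → ℝ} (hv : ∀ d, c ≤ v d)
    (k : Fin M) : c ≤ (P *ᵥ v) k :=
  (mulVec_const h1 c k).symm.trans_le
    (show ∑ d, P k d * c ≤ ∑ d, P k d * v d from
      Finset.sum_le_sum fun d _ => mul_le_mul_of_nonneg_left (hv d) (hP k d))

theorem mulVec_le {M : ℕ} {P : Matrix (Fin M) (Fin M) ℝ} (hP : ∀ k d, 0 ≤ P k d)
    (h1 : P *ᵥ (fun _ => 1) = fun _ => 1) {c : ℝ} {v : Fin M → ℝ} (hv : ∀ d, v d ≤ c)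
    (k : Fin M) : (P *ᵥ v) k ≤ c :=
  le_of_le_of_eq
    (show ∑ d, P k d * v d ≤ ∑ d, P k d * c from
      Finset.sum_le_sum fun d _ => mul_le_mul_of_nonneg_left (hv d) (hP k d))
    (mulVec_const h1 c k)

theorem nHat_nonneg {M N : ℕ} {P : Matrix (Fin M) (Fin M) ℝ} (hP : ∀ k d, 0 ≤ P k d)
    (h1 : P *ᵥ (fun _ => 1) = fun _ => 1) (a : ℕ → Fin M → Fin N) (i : Fin N) (t : ℕ) (k : Fin M) :
    0 ≤ nHat P a i t k := by
  induction t generalizing k with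
  | zero => simp [nHat]
  | succ t ih =>
    refine le_mulVec hP h1 (fun d => add_nonneg (ih d) ?_) k
    split_ifs <;> norm_num

theorem nHat_le {M N : ℕ} {P : Matrix (Fin M) (Fin M) ℝ} (hP : ∀ k d, 0 ≤ P k d)
    (h1 : P *ᵥ (fun _ => 1) = fun _ => 1) (a : ℕ → Fin M → Fin N) (i : Fin N) (t : ℕ) (k : Fin M) :
    nHat P a i t k ≤ t := by
  induction t generalizing k with
  | zero => simp [nHat]
  | succ t ih =>
    refine mulVec_le hP h1 (fun d => ?_) k
    push_cast
    refine add_le_add (ih d) ?_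
    dsimp only
    split_ifs <;> norm_num

/-- All agents sample the arm together during initialization, and averaging with nonnegative weights
of total 1 preserves lower bounds. This keeps the denominators of the index positive and gives the
peeling its starting level. -/
theorem one_le_nHat {M N : ℕ} {P : Matrix (Fin M) (Fin M) ℝ} (hP : ∀ k d, 0 ≤ P k d)
    (h1 : P *ᵥ (fun _ => 1) = fun _ => 1) {a : ℕ → Fin M → Fin N} {i : Fin N}
    (ha : ∀ k, a (i.val + 1) k = i) {t : ℕ} (ht : i.val + 1 ≤ t) (k : Fin M) :
    1 ≤ nHat P a i t k := by
  induction t, ht using Nat.le_induction generalizing k with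
  | base =>
    refine le_mulVec hP h1 (fun d => ?_) k
    simpa [ha] using nHat_nonneg hP h1 a i _ d
  | succ t ht ih =>
    refine le_mulVec hP h1 (fun d => ?_) k
    have : (0 : ℝ) ≤ if a (t + 1) d = i then 1 else 0 := by split_ifs <;> norm_num
    have := ih d
    simp only [Pi.add_apply]
    linarith

/-- Closed form of a linear recursion `x (t + 1) = P (x t + z (t + 1))`. -/
theorem consensus_closed_form {M : ℕ} (P : Matrix (Fin M) (Fin M) ℝ) (x z : ℕ → Fin M → ℝ)
    (h0 : x 0 = 0) (hx : ∀ t, x (t + 1) = P *ᵥ (x t + z (t + 1))) (t : ℕ) (k : Fin M) :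
    x t k = ∑ s ∈ Finset.range t, ∑ d, (P ^ (t - s)) k d * z (s + 1) d := by
  have key : x t = ∑ s ∈ Finset.range t, (P ^ (t - s)) *ᵥ z (s + 1) := by
    induction t with
    | zero => simp [h0]
    | succ t ih =>
      rw [hx, ih, Finset.sum_range_succ, Matrix.mulVec_add, Matrix.mulVec_sum]
      congr 1
      · refine Finset.sum_congr rfl fun s hs => ?_
        rw [Matrix.mulVec_mulVec, ← pow_succ', Nat.sub_add_comm (Finset.mem_range.mp hs).le]
      · simp
  rw [key, Finset.sum_apply]
  rfl

theorem nHat_eq_sum {M N : ℕ} (P : Matrix (Fin M) (Fin M) ℝ) (a : ℕ → Fin M → Fin N)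
    (i : Fin N) (t : ℕ) (k : Fin M) :
    nHat P a i t k = ∑ s ∈ Finset.range t, ∑ d,
      (P ^ (t - s)) k d * (if a (s + 1) d = i then 1 else 0) :=
  consensus_closed_form P (nHat P a i) (fun t d => if a t d = i then 1 else 0) rfl
    (fun _ => rfl) t k

theorem sHat_eq_sum {M N : ℕ} (P : Matrix (Fin M) (Fin M) ℝ) (a : ℕ → Fin M → Fin N)
    (y : ℕ → Fin M → Fin N → ℝ) (i : Fin N) (t : ℕ) (k : Fin M) :
    sHat P a y i t k = ∑ s ∈ Finset.range t, ∑ d,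
      (P ^ (t - s)) k d * (if a (s + 1) d = i then y (s + 1) d i else 0) :=
  consensus_closed_form P (sHat P a y i) (fun t d => if a t d = i then y t d i else 0) rfl
    (fun _ => rfl) t k

theorem sum_pow_sub_le {x : ℝ} (h0 : 0 ≤ x) (h1 : x < 1) (t : ℕ) :
    ∑ s ∈ Finset.range t, x ^ (t - s) ≤ x / (1 - x) := by
  have hx : 0 < 1 - x := sub_pos.mpr h1
  induction t with
  | zero => simpa using div_nonneg h0 hx.le
  | succ t ih =>
    have : ∑ s ∈ Finset.range t, x ^ (t + 1 - s) = x * ∑ s ∈ Finset.range t, x ^ (t - s) := by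
      rw [Finset.mul_sum]
      refine Finset.sum_congr rfl fun s hs => ?_
      rw [← pow_succ', Nat.sub_add_comm (Finset.mem_range.mp hs).le]
    rw [Finset.sum_range_succ, this, Nat.add_sub_cancel_left, pow_one]
    calc x * ∑ s ∈ Finset.range t, x ^ (t - s) + x ≤ x * (x / (1 - x)) + x := by gcongr
      _ = x / (1 - x) := by field_simp; ring

/-- Number of selections of arm `i` by all agents until time `t`. -/
def selCount {M N : ℕ} (a : ℕ → Fin M → Fin N) (i : Fin N) (t : ℕ) : ℝ :=
  ∑ s ∈ Finset.range t, ∑ d, if a (s + 1) d = i then 1 else 0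

theorem sum_split_first {M : ℕ} (z : Fin M) (hz : z.val = 0) (g : Fin M → ℝ) :
    ∑ p, g p = g z + ∑ p : Fin M with 0 < p.val, g p := by
  rw [← Finset.add_sum_erase _ _ (Finset.mem_univ z)]
  congr 1
  refine Finset.sum_congr ?_ fun _ _ => rfl
  ext p
  simp [Fin.ext_iff, hz, Nat.pos_iff_ne_zero]

/-- The constant mode reproduces the average count exactly; all other modes are bounded in absolute
value by geometric series. -/
theorem selCount_div_sub_epsN_le_nHat {M N : ℕ} {P : Matrix (Fin M) (Fin M) ℝ}
    {lam : Fin M → ℝ} {u : Fin M → Fin M → ℝ} (h : IsOrderedEigenbasis P lam u)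
    {z : Fin M} (hz : z.val = 0) (hlz : lam z = 1) (huz : ∀ k d, u z k * u z d = 1 / M)
    (hlt : ∀ p : Fin M, 0 < p.val → |lam p| < 1)
    (a : ℕ → Fin M → Fin N) (i : Fin N) (t : ℕ) (k : Fin M) :
    selCount a i t / M - epsN lam ≤ nHat P a i t k := by
  set ξ : ℕ → Fin M → ℝ := fun s d => if a (s + 1) d = i then 1 else 0 with hξ
  have hξ1 : ∀ s d, ξ s d ^ 2 ≤ 1 := fun s d => by simp only [hξ]; split_ifs <;> norm_num
  -- Cauchy–Schwarz for a unit eigenvector and a 0/1 vector of norm at most `√M`; this is the source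
  -- of the factor `√M` in `ε_n`.
  have hX : ∀ p s, |∑ d, u p d * ξ s d| ≤ √(M : ℝ) := by
    intro p s
    apply Real.abs_le_sqrt
    refine (Finset.sum_mul_sq_le_sq_mul_sq _ _ _).trans ?_
    have h1 : ∑ d, u p d ^ 2 = 1 := by
      simpa [dotProduct, sq] using h.orthonormal p p
    rw [h1, one_mul]
    exact (Finset.sum_le_sum fun d _ => hξ1 s d).trans (by simp)
  have hexp : nHat P a i t k = selCount a i t / M
      + ∑ p : Fin M with 0 < p.val, ∑ s ∈ Finset.range t,
          lam p ^ (t - s) * (u p k * ∑ d, u p d * ξ s d) := by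
    rw [nHat_eq_sum, selCount, Finset.sum_div, Finset.sum_comm (s := Finset.filter _ _),
      ← Finset.sum_add_distrib]
    refine Finset.sum_congr rfl fun s _ => ?_
    calc ∑ d, (P ^ (t - s)) k d * ξ s d
        = ∑ d, (1 / M * ξ s d + ∑ p : Fin M with 0 < p.val,
            lam p ^ (t - s) * (u p k * u p d) * ξ s d) := by
          refine Finset.sum_congr rfl fun d _ => ?_
          rw [h.pow_apply, sum_split_first z hz, hlz, one_pow, one_mul, huz, add_mul,
            Finset.sum_mul]
      _ = _ := by
          rw [Finset.sum_add_distrib, Finset.sum_comm, ← Finset.mul_sum, one_div, inv_mul_eq_div]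
          congr 1
          refine Finset.sum_congr rfl fun p _ => ?_
          rw [Finset.mul_sum, Finset.mul_sum]
          exact Finset.sum_congr rfl fun d _ => by ring
  rw [hexp, sub_eq_add_neg]
  refine add_le_add le_rfl (neg_le_of_abs_le ?_)
  rw [epsN, Finset.mul_sum]
  refine (Finset.abs_sum_le_sum_abs _ _).trans (Finset.sum_le_sum fun p hp => ?_)
  have hp1 := hlt p (Finset.mem_filter.mp hp).2
  refine (Finset.abs_sum_le_sum_abs _ _).trans ?_
  calc ∑ s ∈ Finset.range t, |lam p ^ (t - s) * (u p k * ∑ d, u p d * ξ s d)|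
      ≤ ∑ s ∈ Finset.range t, √(M : ℝ) * |lam p| ^ (t - s) := by
        refine Finset.sum_le_sum fun s _ => ?_
        rw [abs_mul, abs_mul, abs_pow, mul_comm]
        gcongr
        calc |u p k| * |∑ d, u p d * ξ s d| ≤ 1 * √(M : ℝ) :=
              mul_le_mul (h.abs_le_one p k) (hX p s) (abs_nonneg _) zero_le_one
          _ = √(M : ℝ) := one_mul _
    _ ≤ _ := by
        rw [← Finset.mul_sum]
        gcongr
        exact sum_pow_sub_le (abs_nonneg _) hp1 t

theorem epsN_nonneg {M : ℕ} {lam : Fin M → ℝ}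
    (hlt : ∀ p : Fin M, 0 < p.val → |lam p| < 1) : 0 ≤ epsN lam :=
  mul_nonneg (Real.sqrt_nonneg _) (Finset.sum_nonneg fun p hp =>
    div_nonneg (abs_nonneg _) (sub_nonneg.mpr (hlt p (Finset.mem_filter.mp hp).2).le))

/-! ### The variance proxy -/

theorem nuPos_nonneg {M : ℕ} (u : Fin M → Fin M → ℝ) (p j : Fin M) : 0 ≤ nuPos u p j :=
  Finset.sum_nonneg fun _ hd => (Finset.mem_filter.mp hd).2

theorem nuNeg_nonpos {M : ℕ} (u : Fin M → Fin M → ℝ) (p j : Fin M) : nuNeg u p j ≤ 0 :=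
  Finset.sum_nonpos fun _ hd => (Finset.mem_filter.mp hd).2

theorem sum_le_nuPos {M : ℕ} (u : Fin M → Fin M → ℝ) (p j : Fin M) {ξ : Fin M → ℝ}
    (h0 : ∀ d, 0 ≤ ξ d) (h1 : ∀ d, ξ d ≤ 1) : ∑ d, u p d * u j d * ξ d ≤ nuPos u p j := by
  rw [nuPos, Finset.sum_filter]
  refine Finset.sum_le_sum fun d _ => ?_
  split_ifs with hd
  · exact mul_le_of_le_one_right hd (h1 d)
  · exact mul_nonpos_of_nonpos_of_nonneg (not_le.mp hd).le (h0 d)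

theorem nuNeg_le_sum {M : ℕ} (u : Fin M → Fin M → ℝ) (p j : Fin M) {ξ : Fin M → ℝ}
    (h0 : ∀ d, 0 ≤ ξ d) (h1 : ∀ d, ξ d ≤ 1) : nuNeg u p j ≤ ∑ d, u p d * u j d * ξ d := by
  rw [nuNeg, Finset.sum_filter]
  refine Finset.sum_le_sum fun d _ => ?_
  split_ifs with hd
  · nlinarith [h0 d, h1 d]
  · exact mul_nonneg (not_le.mp hd).le (h0 d)

theorem aCoef_nonneg {M : ℕ} (lam : Fin M → ℝ) (u : Fin M → Fin M → ℝ) (k p j : Fin M) :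
    0 ≤ aCoef lam u k p j := by
  rw [aCoef]
  split_ifs with h1 h2
  · exact mul_nonneg (nuPos_nonneg u p j) h2
  · exact mul_nonneg_of_nonpos_of_nonpos (nuNeg_nonpos u p j) (not_le.mp h2).le
  · exact mul_nonneg (le_max_of_le_left (abs_nonneg _)) (abs_nonneg _)

/-- For a nonnegative product of eigenvalues the sign of the power is known, so only the extreme of
the inner sum matching the sign of `u p k * u j k` matters. For a negative product the sign
alternates with `τ`, and absolute values are needed. -/
theorem pow_mul_le_aCoef {M : ℕ} (lam : Fin M → ℝ) (u : Fin M → Fin M → ℝ) (k p j : Fin M)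
    {ξ : Fin M → ℝ} (h0 : ∀ d, 0 ≤ ξ d) (h1 : ∀ d, ξ d ≤ 1) (τ : ℕ) :
    (lam p * lam j) ^ τ * ((u p k * u j k) * ∑ d, u p d * u j d * ξ d) ≤
      |lam p * lam j| ^ τ * aCoef lam u k p j := by
  have hX1 := sum_le_nuPos u p j h0 h1
  have hX2 := nuNeg_le_sum u p j h0 h1
  set X := ∑ d, u p d * u j d * ξ d
  rw [aCoef]
  split_ifs with hl hc
  · rw [abs_of_nonneg hl]
    gcongr ?_ * ?_
    rw [mul_comm]
    gcongr
  · rw [abs_of_nonneg hl]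
    gcongr ?_ * ?_
    nlinarith [not_le.mp hc]
  · refine (le_abs_self _).trans ?_
    rw [abs_mul, abs_pow, abs_mul (u p k * u j k), mul_comm |u p k * u j k|]
    gcongr ?_ * (?_ * ?_)
    refine abs_le.mpr ⟨?_, hX1.trans (le_max_right _ _)⟩
    have := le_max_left |nuNeg u p j| (nuPos u p j)
    have := neg_abs_le (nuNeg u p j)
    linarith

/-- The sum of the squared consensus weights of all selections of arm `i`. -/
noncomputable def varProxy {M N : ℕ} (P : Matrix (Fin M) (Fin M) ℝ) (a : ℕ → Fin M → Fin N)
    (i : Fin N) (t : ℕ) (k : Fin M) : ℝ :=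
  ∑ s ∈ Finset.range t, ∑ d, (P ^ (t - s)) k d ^ 2 * (if a (s + 1) d = i then 1 else 0)

/-- Write the squared weight as a product of two equal factors and split the mode `1/M` off one of
them only. The other factor, kept whole, rebuilds `n̂/M`; the rest is the double sum in `ε_c^k`,
whose two indices therefore start at different values. -/
theorem varProxy_le {M N : ℕ} {P : Matrix (Fin M) (Fin M) ℝ}
    {lam : Fin M → ℝ} {u : Fin M → Fin M → ℝ} (h : IsOrderedEigenbasis P lam u)
    {z : Fin M} (hz : z.val = 0) (hlz : lam z = 1) (huz : ∀ k d, u z k * u z d = 1 / M)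
    (hlt : ∀ p : Fin M, 0 < p.val → |lam p| < 1)
    (a : ℕ → Fin M → Fin N) (i : Fin N) (t : ℕ) (k : Fin M) :
    varProxy P a i t k ≤ (nHat P a i t k + epsC lam u k) / M := by
  set ξ : ℕ → Fin M → ℝ := fun s d => if a (s + 1) d = i then 1 else 0 with hξ
  have hξ0 : ∀ s d, 0 ≤ ξ s d := fun s d => by simp only [hξ]; split_ifs <;> norm_num
  have hξ1 : ∀ s d, ξ s d ≤ 1 := fun s d => by simp only [hξ]; split_ifs <;> norm_num
  have hM : (M : ℝ) ≠ 0 := by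
    have := k.pos
    positivity
  have hle1 : ∀ p, |lam p| ≤ 1 := fun p => by
    rcases Nat.eq_zero_or_pos p.val with hp | hp
    · rw [Fin.ext (hp.trans hz.symm), hlz, abs_one]
    · exact (hlt p hp).le
  have hexp : varProxy P a i t k = nHat P a i t k / M
      + ∑ p, ∑ j : Fin M with 0 < j.val, ∑ s ∈ Finset.range t,
          (lam p * lam j) ^ (t - s) * ((u p k * u j k) * ∑ d, u p d * u j d * ξ s d) := by
    have hrhs : ∑ p, ∑ j : Fin M with 0 < j.val, ∑ s ∈ Finset.range t,
          (lam p * lam j) ^ (t - s) * ((u p k * u j k) * ∑ d, u p d * u j d * ξ s d)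
        = ∑ s ∈ Finset.range t, ∑ p, ∑ j : Fin M with 0 < j.val,
          (lam p * lam j) ^ (t - s) * ((u p k * u j k) * ∑ d, u p d * u j d * ξ s d) := by
      rw [Finset.sum_comm (s := Finset.range t)]
      exact Finset.sum_congr rfl fun p _ => Finset.sum_comm
    rw [hrhs, nHat_eq_sum, varProxy, Finset.sum_div, ← Finset.sum_add_distrib]
    refine Finset.sum_congr rfl fun s _ => ?_
    calc ∑ d, (P ^ (t - s)) k d ^ 2 * ξ s d
        = ∑ d, ((P ^ (t - s)) k d * ξ s d / M + ∑ p, ∑ j : Fin M with 0 < j.val,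
            (lam p * lam j) ^ (t - s) * ((u p k * u j k) * (u p d * u j d * ξ s d))) := by
          refine Finset.sum_congr rfl fun d _ => ?_
          have h2 : (P ^ (t - s)) k d = 1 / M + ∑ j : Fin M with 0 < j.val,
              lam j ^ (t - s) * (u j k * u j d) := by
            rw [h.pow_apply, sum_split_first z hz, hlz, one_pow, one_mul, huz]
          rw [sq]
          nth_rewrite 2 [h2]
          have h3 : (P ^ (t - s)) k d * (1 / M + ∑ j : Fin M with 0 < j.val,
              lam j ^ (t - s) * (u j k * u j d)) * ξ s d = (P ^ (t - s)) k d * ξ s d / M +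
              (P ^ (t - s)) k d * (∑ j : Fin M with 0 < j.val,
              lam j ^ (t - s) * (u j k * u j d)) * ξ s d := by ring
          rw [h3]
          congr 1
          rw [h.pow_apply, Finset.sum_mul_sum, Finset.sum_mul]
          refine Finset.sum_congr rfl fun p _ => ?_
          rw [Finset.sum_mul]
          refine Finset.sum_congr rfl fun j _ => ?_
          rw [mul_pow]
          ring
      _ = _ := by
          rw [Finset.sum_add_distrib, Finset.sum_div, Finset.sum_comm]
          congr 1
          refine Finset.sum_congr rfl fun p _ => ?_
          rw [Finset.sum_comm]
          refine Finset.sum_congr rfl fun j _ => ?_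
          rw [Finset.mul_sum, Finset.mul_sum]
  rw [hexp, add_div]
  refine add_le_add le_rfl ?_
  rw [epsC, mul_div_cancel_left₀ _ hM]
  refine Finset.sum_le_sum fun p _ => Finset.sum_le_sum fun j hj => ?_
  have hlj : |lam p * lam j| < 1 := by
    rw [abs_mul]
    exact (mul_le_of_le_one_left (abs_nonneg _) (hle1 p)).trans_lt
      (hlt j (Finset.mem_filter.mp hj).2)
  calc ∑ s ∈ Finset.range t,
          (lam p * lam j) ^ (t - s) * ((u p k * u j k) * ∑ d, u p d * u j d * ξ s d)
      ≤ ∑ s ∈ Finset.range t, |lam p * lam j| ^ (t - s) * aCoef lam u k p j :=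
        Finset.sum_le_sum fun s _ => pow_mul_le_aCoef lam u k p j (hξ0 s) (hξ1 s) _
    _ ≤ _ := by
        rw [← Finset.sum_mul]
        exact mul_le_mul_of_nonneg_right (sum_pow_sub_le (abs_nonneg _) hlj t)
          (aCoef_nonneg lam u k p j)

/-! ### The exponential supermartingale -/

/-- One step of a supermartingale argument: split along `B`, which belongs to the past, and use
independence only on `B`. -/
theorem lintegral_mul_ite_le {Ω : Type*} [mΩ : MeasurableSpace Ω] {μ : Measure Ω}
    {𝓕 𝓖 : MeasurableSpace Ω} (h𝓕 : 𝓕 ≤ mΩ) (h𝓖 : 𝓖 ≤ mΩ) (hind : Indep 𝓕 𝓖 μ)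
    {F g : Ω → ENNReal} (hF : Measurable[𝓕] F) (hg : Measurable[𝓖] g)
    {B : Set Ω} [DecidablePred (· ∈ B)] (hB : MeasurableSet[𝓕] B) (hg1 : ∫⁻ ω, g ω ∂μ ≤ 1) :
    ∫⁻ ω, F ω * (if ω ∈ B then g ω else 1) ∂μ ≤ ∫⁻ ω, F ω ∂μ := by
  have hB' := h𝓕 _ hB
  have hFi : Measurable[𝓕] (B.indicator F) := hF.indicator hB
  have hFi' : Measurable[𝓕] (Bᶜ.indicator F) := hF.indicator hB.compl
  calc ∫⁻ ω, F ω * (if ω ∈ B then g ω else 1) ∂μ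
      = ∫⁻ ω, (B.indicator F ω * g ω + Bᶜ.indicator F ω) ∂μ := by
        refine lintegral_congr fun ω => ?_
        by_cases h : ω ∈ B <;> simp [h]
    _ = (∫⁻ ω, B.indicator F ω ∂μ) * (∫⁻ ω, g ω ∂μ) + ∫⁻ ω, Bᶜ.indicator F ω ∂μ := by
        rw [lintegral_add_right _ (hFi'.mono h𝓕 le_rfl),
          lintegral_mul_eq_lintegral_mul_lintegral_of_independent_measurableSpace h𝓕 h𝓖 hind hFi hg]
    _ ≤ (∫⁻ ω, B.indicator F ω ∂μ) + ∫⁻ ω, Bᶜ.indicator F ω ∂μ := by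
        gcongr
        exact mul_le_of_le_one_right' hg1
    _ = ∫⁻ ω, F ω ∂μ := by
        rw [← lintegral_add_right _ (hFi'.mono h𝓕 le_rfl)]
        refine lintegral_congr fun ω => ?_
        by_cases h : ω ∈ B <;> simp [h]

/-- The σ-algebra generated by the reward vectors with (time, agent) index in `S`. -/
@[reducible] def rewardsOn {M N : ℕ} {Ω : Type*} (r : ℕ → Fin M → Fin N → Ω → ℝ)
    (S : Set (ℕ × Fin M)) : MeasurableSpace Ω :=
  ⨆ q ∈ S, MeasurableSpace.comap (fun ω (i : Fin N) => r q.1 q.2 i ω) inferInstance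

theorem measurable_rewardsOn {M N : ℕ} {Ω : Type*} (r : ℕ → Fin M → Fin N → Ω → ℝ)
    {S : Set (ℕ × Fin M)} {s : ℕ} {d : Fin M} (h : (s, d) ∈ S) (i : Fin N) :
    Measurable[rewardsOn r S] (r s d i) := by
  have h1 : Measurable[rewardsOn r S] (fun ω (i : Fin N) => r s d i ω) :=
    Measurable.of_comap_le (le_iSup₂_of_le (s, d) h le_rfl)
  exact (measurable_pi_apply i).comp h1

theorem pastRewards_le_rewardsOn {M N : ℕ} {Ω : Type*} (r : ℕ → Fin M → Fin N → Ω → ℝ)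
    {S : Set (ℕ × Fin M)} {t : ℕ} (h : ∀ s d, 1 ≤ s → s < t → (s, d) ∈ S) :
    pastRewards r t ≤ rewardsOn r S :=
  iSup₂_le fun s hs => iSup₂_le fun k i =>
    (measurable_rewardsOn r (h s k hs.1 hs.2) i).comap_le

theorem pastRewards_le {M N : ℕ} {Ω : Type*} [mΩ : MeasurableSpace Ω] {μ : Measure Ω}
    {p : Fin N → Measure ℝ} {r : ℕ → Fin M → Fin N → Ω → ℝ} (hr : IsRewardProcess μ p r) (t : ℕ) :
    pastRewards r t ≤ mΩ :=
  iSup₂_le fun _ _ => iSup₂_le fun _ _ => (hr.measurable _ _ _).comap_le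

theorem rewardsOn_le {M N : ℕ} {Ω : Type*} [mΩ : MeasurableSpace Ω] {μ : Measure Ω}
    {p : Fin N → Measure ℝ} {r : ℕ → Fin M → Fin N → Ω → ℝ} (hr : IsRewardProcess μ p r)
    (S : Set (ℕ × Fin M)) : rewardsOn r S ≤ mΩ :=
  iSup₂_le fun _ _ => (measurable_pi_lambda _ fun _ => hr.measurable _ _ _).comap_le

theorem indep_rewardsOn {M N : ℕ} {Ω : Type*} [MeasurableSpace Ω] {μ : Measure Ω}
    {p : Fin N → Measure ℝ} {r : ℕ → Fin M → Fin N → Ω → ℝ} (hr : IsRewardProcess μ p r)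
    {S T : Set (ℕ × Fin M)} (h : Disjoint S T) : Indep (rewardsOn r S) (rewardsOn r T) μ :=
  indep_iSup_of_disjoint
    (fun _ => (measurable_pi_lambda _ fun _ => hr.measurable _ _ _).comap_le) hr.indep h

/-- Induction over time and, within one time, over agents: each new factor is either 1 or a function
of a fresh reward, and which of the two is decided by the past. Extended nonnegative integrals avoid
integrability questions for the products. -/
theorem lintegral_prod_selected_le_one {M N : ℕ} {Ω : Type*} [MeasurableSpace Ω]
    {μ : Measure Ω} [IsProbabilityMeasure μ] {p : Fin N → Measure ℝ}
    {r : ℕ → Fin M → Fin N → Ω → ℝ} (hr : IsRewardProcess μ p r)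
    {arm : ℕ → Fin M → Ω → Fin N}
    (harm : ∀ t : ℕ, 1 ≤ t → ∀ k : Fin M, Measurable[pastRewards r t] (arm t k)) (i : Fin N)
    {g : ℕ → Fin M → ℝ → ENNReal} (hgm : ∀ s d, Measurable (g s d))
    (hg : ∀ s d, ∫⁻ ω, g s d (r (s + 1) d i ω) ∂μ ≤ 1) (n : ℕ) :
    ∫⁻ ω, ∏ s ∈ Finset.range n, ∏ d,
      (if arm (s + 1) d ω = i then g s d (r (s + 1) d i ω) else 1) ∂μ ≤ 1 := by
  set φ : ℕ → Fin M → Ω → ENNReal := fun s d ω =>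
    if arm (s + 1) d ω = i then g s d (r (s + 1) d i ω) else 1 with hφdef
  have hB : ∀ {S : Set (ℕ × Fin M)} (s : ℕ) (d : Fin M),
      (∀ s' d', 1 ≤ s' → s' < s + 1 → (s', d') ∈ S) →
      MeasurableSet[rewardsOn r S] {ω | arm (s + 1) d ω = i} := fun s d hS =>
    pastRewards_le_rewardsOn r hS _ (harm (s + 1) (by omega) d (MeasurableSet.singleton i))
  have hφ : ∀ {S : Set (ℕ × Fin M)} (s : ℕ) (d : Fin M),
      (∀ s' d', 1 ≤ s' → s' < s + 1 → (s', d') ∈ S) → (s + 1, d) ∈ S →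
      Measurable[rewardsOn r S] (φ s d) := fun s d hS hd =>
    Measurable.ite (hB s d hS) ((hgm s d).comp (measurable_rewardsOn r hd i)) measurable_const
  induction n with
  | zero => simp
  | succ n ih =>
    simp only [Finset.prod_range_succ]
    suffices h : ∀ A : Finset (Fin M), ∫⁻ ω, (∏ s ∈ Finset.range n, ∏ d, φ s d ω) *
        ∏ d ∈ A, φ n d ω ∂μ ≤ 1 from h Finset.univ
    intro A
    induction A using Finset.induction_on with
    | empty => simpa using ih
    | insert d A hd ihA =>
      refine le_trans ?_ ihA
      -- Everything revealed before agent `d`'s reward: all rewards up to time `n`, and at time `n +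
      -- 1` those of the agents in `A`.
      let S : Set (ℕ × Fin M) := {q | q.1 ≤ n ∨ (q.1 = n + 1 ∧ q.2 ∈ A)}
      have hdisj : Disjoint S {(n + 1, d)} := by
        rw [Set.disjoint_singleton_right]
        rintro (h | h)
        · simp at h
        · exact hd h.2
      have hS : ∀ s' d', 1 ≤ s' → s' < n + 1 → (s', d') ∈ S := fun s' d' _ h =>
        Or.inl (by simpa using Nat.lt_succ_iff.mp h)
      have hF : Measurable[rewardsOn r S]
          (fun ω => (∏ s ∈ Finset.range n, ∏ d, φ s d ω) * ∏ d ∈ A, φ n d ω) := by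
        refine Measurable.mul ?_ ?_
        · refine Finset.measurable_prod _ fun s hs => Finset.measurable_prod _ fun d' _ => ?_
          have hs := Finset.mem_range.mp hs
          exact hφ s d' (fun s' d'' h1 h2 => hS s' d'' h1 (by omega))
            (Or.inl (by simpa using hs))
        · exact Finset.measurable_prod _ fun d' hd' => hφ n d' hS (Or.inr ⟨rfl, hd'⟩)
      have hg' : Measurable[rewardsOn r {(n + 1, d)}] (fun ω => g n d (r (n + 1) d i ω)) :=
        (hgm n d).comp (measurable_rewardsOn r (S := {(n + 1, d)}) (Set.mem_singleton _) i)
      have key := lintegral_mul_ite_le (rewardsOn_le hr S) (rewardsOn_le hr {(n + 1, d)})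
        (indep_rewardsOn hr hdisj) hF hg' (B := {ω | arm (n + 1) d ω = i}) (hB n d hS) (hg n d)
      refine le_trans (le_of_eq (lintegral_congr fun ω => ?_)) key
      rw [Finset.prod_insert hd, mul_comm (φ n d ω), ← mul_assoc]
      rfl

theorem IsSubGaussian.lintegral_exp_le_one {Ω : Type*} [MeasurableSpace Ω] {μ : Measure Ω}
    [IsProbabilityMeasure μ] {p : Measure ℝ} {σ : ℝ} (hp : IsSubGaussian p σ) {X : Ω → ℝ}
    (hX : Measurable X) (hlaw : HasLaw X p μ) (c : ℝ) :
    ∫⁻ ω, ENNReal.ofReal (Real.exp (c * (X ω - ∫ x, x ∂p) - c ^ 2 * σ ^ 2 / 2)) ∂μ ≤ 1 := by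
  have hprob : IsProbabilityMeasure p := by
    rw [← hlaw.map_eq]
    exact Measure.isProbabilityMeasure_map hX.aemeasurable
  obtain ⟨hint, hcgf⟩ := hp.2 c
  set m := ∫ x, x ∂p
  have hmap : ∫⁻ ω, ENNReal.ofReal (Real.exp (c * (X ω - m) - c ^ 2 * σ ^ 2 / 2)) ∂μ =
      ∫⁻ x, ENNReal.ofReal (Real.exp (c * (x - m) - c ^ 2 * σ ^ 2 / 2)) ∂p := by
    rw [← hlaw.map_eq, lintegral_map (by fun_prop) hX]
  have hexp : ∀ x, Real.exp (c * (x - m) - c ^ 2 * σ ^ 2 / 2) =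
      Real.exp (c * x) * Real.exp (-(m * c + σ ^ 2 * c ^ 2 / 2)) := fun x => by
    rw [← Real.exp_add]
    congr 1
    ring
  rw [hmap, ← ofReal_integral_eq_lintegral_ofReal]
  · rw [← ENNReal.ofReal_one]
    refine ENNReal.ofReal_le_ofReal ?_
    simp only [hexp]
    rw [integral_mul_const, Real.exp_neg, ← div_eq_mul_inv, div_le_one (Real.exp_pos _)]
    -- Exponentiating the bound on the cumulant generating function requires the argument of the
    -- logarithm to be positive.
    have hmgf : 0 < mgf id p c := mgf_pos hint
    exact (Real.log_le_iff_le_exp hmgf).mp hcgf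
  · simp only [hexp]
    exact hint.mul_const _
  · exact ae_of_all _ fun x => (Real.exp_pos _).le

/-- The exponential moment of the consensus estimation error, compensated by its variance proxy. -/
theorem lintegral_exp_estimation_error_le_one {M N : ℕ} {Ω : Type*} [MeasurableSpace Ω]
    {μ : Measure Ω} [IsProbabilityMeasure μ] {p : Fin N → Measure ℝ} {σ : ℝ}
    (hp : ∀ i, IsSubGaussian (p i) σ)
    {r : ℕ → Fin M → Fin N → Ω → ℝ} (hr : IsRewardProcess μ p r)
    {arm : ℕ → Fin M → Ω → Fin N}
    (harm : ∀ t : ℕ, 1 ≤ t → ∀ k : Fin M, Measurable[pastRewards r t] (arm t k))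
    (P : Matrix (Fin M) (Fin M) ℝ) (i : Fin N) (t : ℕ) (k : Fin M) (θ : ℝ) :
    ∫⁻ ω, ENNReal.ofReal (Real.exp
      (θ * (sHat P (fun s j => arm s j ω) (fun s j l => r s j l ω) i t k
        - (∫ x, x ∂(p i)) * nHat P (fun s j => arm s j ω) i t k)
        - θ ^ 2 * σ ^ 2 / 2 * varProxy P (fun s j => arm s j ω) i t k)) ∂μ ≤ 1 := by
  set m := ∫ x, x ∂(p i)
  -- A reward received at time `s + 1` passes through `P` exactly `t - s` times before it is read at
  -- time `t`. The weight is deterministic, so it can be absorbed into the exponential parameter.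
  let w : ℕ → Fin M → ℝ := fun s d => (P ^ (t - s)) k d
  have h := lintegral_prod_selected_le_one hr harm i
    (g := fun s d x => ENNReal.ofReal
      (Real.exp ((θ * w s d) * (x - m) - (θ * w s d) ^ 2 * σ ^ 2 / 2)))
    (fun s d => by fun_prop)
    (fun s d => (hp i).lintegral_exp_le_one (hr.measurable _ _ _) (hr.law _ _ _) _) t
  refine le_trans (le_of_eq (lintegral_congr fun ω => ?_)) h
  have hsum : θ * (sHat P (fun s j => arm s j ω) (fun s j l => r s j l ω) i t k
        - m * nHat P (fun s j => arm s j ω) i t k)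
        - θ ^ 2 * σ ^ 2 / 2 * varProxy P (fun s j => arm s j ω) i t k =
      ∑ s ∈ Finset.range t, ∑ d, if arm (s + 1) d ω = i then
        (θ * w s d) * (r (s + 1) d i ω - m) - (θ * w s d) ^ 2 * σ ^ 2 / 2 else 0 := by
    rw [sHat_eq_sum, nHat_eq_sum, varProxy]
    simp only [Finset.mul_sum, ← Finset.sum_sub_distrib]
    refine Finset.sum_congr rfl fun s _ => Finset.sum_congr rfl fun d _ => ?_
    split_ifs
    · simp only [w]
      ring
    · ring
  rw [hsum, Real.exp_sum, ENNReal.ofReal_prod_of_nonneg fun _ _ => (Real.exp_pos _).le]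
  refine Finset.prod_congr rfl fun s _ => ?_
  rw [Real.exp_sum, ENNReal.ofReal_prod_of_nonneg fun _ _ => (Real.exp_pos _).le]
  refine Finset.prod_congr rfl fun d _ => ?_
  split_ifs <;> simp

/-! ### Self-normalized deviation bound by peeling -/

theorem gFun_pos {η : ℝ} (hη : η ∈ Set.Ioo (0 : ℝ) 4) : 0 < gFun η := by
  rw [gFun]
  nlinarith [hη.1, hη.2]

/-- Here `y - y²/2 = (1 - (1 - y)²)/2`, and `|1 - y| ≤ z - 1 ≤ η/4` by Bernoulli's inequality for
the fourth power. This is where `G(η) = 1 - η²/16` comes from. -/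
theorem gFun_le_of_mem_slice {η z y : ℝ} (hz : 1 ≤ z)
    (hz4 : z ^ 4 = 1 + η) (h1 : z⁻¹ ≤ y) (h2 : y ≤ z) : gFun η / 2 ≤ y - y ^ 2 / 2 := by
  have hz5 : z - 1 ≤ η / 4 := by
    have := one_add_mul_le_pow (a := z - 1) (by linarith) 4
    rw [add_sub_cancel, hz4] at this
    push_cast at this
    linarith
  have hinv : 1 - z⁻¹ ≤ z - 1 := by
    have hz0 : (0 : ℝ) < z := by linarith
    have : z * z⁻¹ = 1 := mul_inv_cancel₀ hz0.ne'
    nlinarith [sq_nonneg (z - 1), inv_pos.mpr hz0]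
  have h3 : (1 - y) ^ 2 ≤ (η / 4) ^ 2 := sq_le_sq' (by linarith) (by linarith)
  rw [gFun]
  linarith

/-- Markov's inequality with one parameter for the whole slice. The ideal `δ/(σ²√W)` is random;
replacing `√W` by a fixed value inside the slice costs only the factor `G(η)`. -/
theorem measure_slice_le {Ω : Type*} [MeasurableSpace Ω] {μ : Measure Ω}
    {S V W : Ω → ℝ} (hS : Measurable S) (hV : Measurable V) {σ η : ℝ} (hσ : 0 < σ)
    (hη : 0 ≤ η)
    (hexp : ∀ θ : ℝ, ∫⁻ ω, ENNReal.ofReal (Real.exp (θ * S ω - θ ^ 2 * σ ^ 2 / 2 * V ω)) ∂μ ≤ 1)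
    (hVW : ∀ ω, V ω ≤ W ω) {δ A : ℝ} (hδ : 0 ≤ δ) (hA : 0 < A) :
    μ {ω | δ * √(W ω) ≤ S ω ∧ A ≤ W ω ∧ W ω ≤ A * (1 + η)} ≤
      ENNReal.ofReal (Real.exp (-(δ ^ 2 * gFun η / (2 * σ ^ 2)))) := by
  set z : ℝ := √(√(1 + η)) with hz
  have hz1 : 1 ≤ z := Real.one_le_sqrt.mpr (Real.one_le_sqrt.mpr (by linarith))
  have hz2 : z ^ 2 = √(1 + η) := Real.sq_sqrt (Real.sqrt_nonneg _)
  have hz4 : z ^ 4 = 1 + η := by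
    rw [show z ^ 4 = (z ^ 2) ^ 2 by ring, hz2, Real.sq_sqrt (by linarith)]
  have hz0 : 0 < z := by linarith
  -- The geometric mean of the smallest and largest values of `√W` on the slice, so that `√W / x`
  -- ranges over `[z⁻¹, z]`.
  set x : ℝ := √A * z with hx
  have hx0 : 0 < x := mul_pos (Real.sqrt_pos.mpr hA) hz0
  set θ : ℝ := δ / (σ ^ 2 * x) with hθ
  have hθ0 : 0 ≤ θ := by positivity
  set b : ℝ := δ ^ 2 * gFun η / (2 * σ ^ 2) with hb
  have hsub : {ω | δ * √(W ω) ≤ S ω ∧ A ≤ W ω ∧ W ω ≤ A * (1 + η)} ⊆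
      {ω | ENNReal.ofReal (Real.exp b) ≤
        ENNReal.ofReal (Real.exp (θ * S ω - θ ^ 2 * σ ^ 2 / 2 * V ω))} := by
    rintro ω ⟨h1, h2, h3⟩
    refine ENNReal.ofReal_le_ofReal (Real.exp_le_exp.mpr ?_)
    have hW0 : 0 ≤ W ω := hA.le.trans h2
    set y : ℝ := √(W ω) / x with hy
    have hWy : √(W ω) = x * y := by rw [hy]; field_simp
    have hy1 : z⁻¹ ≤ y := by
      rw [hy, le_div_iff₀ hx0, hx, mul_comm, mul_assoc, mul_inv_cancel₀ hz0.ne', mul_one]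
      exact Real.sqrt_le_sqrt h2
    have hy2 : y ≤ z := by
      rw [hy, div_le_iff₀ hx0, hx]
      calc √(W ω) ≤ √(A * (1 + η)) := Real.sqrt_le_sqrt h3
        _ = z * (√A * z) := by rw [Real.sqrt_mul hA.le, ← hz2]; ring
    have hG := gFun_le_of_mem_slice hz1 hz4 hy1 hy2
    have hWsq : W ω = (x * y) ^ 2 := by rw [← hWy, Real.sq_sqrt hW0]
    calc b = δ ^ 2 / σ ^ 2 * (gFun η / 2) := by rw [hb]; field_simp
      _ ≤ δ ^ 2 / σ ^ 2 * (y - y ^ 2 / 2) := by gcongr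
      _ = θ * (δ * √(W ω)) - θ ^ 2 * σ ^ 2 / 2 * W ω := by
        rw [hWsq, Real.sqrt_sq (by rw [← hWy]; exact Real.sqrt_nonneg _), hθ]
        field_simp
      _ ≤ θ * S ω - θ ^ 2 * σ ^ 2 / 2 * V ω := by
        gcongr
        exact hVW ω
  refine (measure_mono hsub).trans ?_
  have hmarkov := (mul_meas_ge_le_lintegral
    (show Measurable fun ω => ENNReal.ofReal (Real.exp (θ * S ω - θ ^ 2 * σ ^ 2 / 2 * V ω)) by
      fun_prop) (ENNReal.ofReal (Real.exp b))).trans (hexp θ)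
  rw [Real.exp_neg, ENNReal.ofReal_inv_of_pos (Real.exp_pos _)]
  rw [mul_comm] at hmarkov
  exact (ENNReal.le_div_iff_mul_le (Or.inl (by simp [Real.exp_pos])) (Or.inl (by simp))).mpr
    hmarkov |>.trans (by simp)

/-- Cover the range of `W` by slices of ratio `1 + η` starting at `A`, and sum the slice bounds. -/
theorem measureReal_self_normalized_le {Ω : Type*} [MeasurableSpace Ω] {μ : Measure Ω}
    [IsProbabilityMeasure μ]
    {S V W : Ω → ℝ} (hS : Measurable S) (hV : Measurable V) {σ η : ℝ} (hσ : 0 < σ)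
    (hη : 0 < η)
    (hexp : ∀ θ : ℝ, ∫⁻ ω, ENNReal.ofReal (Real.exp (θ * S ω - θ ^ 2 * σ ^ 2 / 2 * V ω)) ∂μ ≤ 1)
    (hVW : ∀ ω, V ω ≤ W ω) {δ A τ : ℝ} (hδ : 0 ≤ δ) (hA : 0 < A) (hτ : 1 ≤ τ)
    (hW1 : ∀ ω, A ≤ W ω) (hW2 : ∀ ω, W ω ≤ A * τ) :
    μ.real {ω | δ * √(W ω) ≤ S ω} ≤
      (Real.log τ / Real.log (1 + η) + 1) * Real.exp (-(δ ^ 2 * gFun η / (2 * σ ^ 2))) := by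
  have hlog : 0 < Real.log (1 + η) := Real.log_pos (by linarith)
  set D : ℕ := ⌊Real.log τ / Real.log (1 + η)⌋₊ with hD
  have hratio : 0 ≤ Real.log τ / Real.log (1 + η) := div_nonneg (Real.log_nonneg hτ) hlog.le
  have hsub : {ω | δ * √(W ω) ≤ S ω} ⊆ ⋃ l ∈ Finset.range (D + 1),
      {ω | δ * √(W ω) ≤ S ω ∧ A * (1 + η) ^ l ≤ W ω ∧ W ω ≤ A * (1 + η) ^ l * (1 + η)} := by
    intro ω hω
    have hη1 : 1 < 1 + η := by linarith
    have hWA : 1 ≤ W ω / A := (one_le_div hA).mpr (hW1 ω)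
    obtain ⟨l, hl1, hl2⟩ := exists_nat_pow_near hWA hη1
    refine Set.mem_biUnion (x := l) ?_ ⟨hω, ?_, ?_⟩
    · refine Finset.mem_coe.mpr (Finset.mem_range.mpr (Nat.lt_succ_iff.mpr (Nat.le_floor ?_)))
      rw [le_div_iff₀ hlog, ← Real.log_pow]
      refine Real.log_le_log (by positivity) (hl1.trans ?_)
      rw [div_le_iff₀ hA, mul_comm]
      exact hW2 ω
    · rw [le_div_iff₀ hA] at hl1
      linarith
    · rw [div_lt_iff₀ hA, pow_succ] at hl2
      linarith
  have hbound : μ {ω | δ * √(W ω) ≤ S ω} ≤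
      ENNReal.ofReal ((D + 1) * Real.exp (-(δ ^ 2 * gFun η / (2 * σ ^ 2)))) := by
    refine (measure_mono hsub).trans ((measure_biUnion_finset_le _ _).trans ?_)
    refine (Finset.sum_le_sum fun l _ =>
      measure_slice_le hS hV hσ hη.le hexp hVW hδ (A := A * (1 + η) ^ l) (by positivity)).trans ?_
    rw [Finset.sum_const, Finset.card_range, nsmul_eq_mul,
      ENNReal.ofReal_mul (by positivity)]
    gcongr
    rw [show ((D : ℝ) + 1) = ((D + 1 : ℕ) : ℝ) by push_cast; rfl, ENNReal.ofReal_natCast]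
  refine (ENNReal.toReal_le_of_le_ofReal (by positivity) hbound).trans ?_
  gcongr
  exact Nat.floor_le hratio

/-! ### Summation of the deviation probabilities -/

/-- Integral comparison, carried out by telescoping with the mean value theorem; the constant is `1
+ 1/(γ - 1)`. -/
theorem sum_rpow_neg_le {γ : ℝ} (hγ : 1 < γ) (n : ℕ) :
    ∑ s ∈ Finset.Ico 1 n, (s : ℝ) ^ (-γ) ≤ γ / (γ - 1) := by
  have hγ1 : 0 < γ - 1 := sub_pos.mpr hγ
  have hstep : ∀ s : ℕ, 1 ≤ s → ((s + 1 : ℕ) : ℝ) ^ (-γ) ≤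
      ((s : ℝ) ^ (1 - γ) - ((s + 1 : ℕ) : ℝ) ^ (1 - γ)) / (γ - 1) := by
    intro s hs
    have hs0 : (0 : ℝ) < s := by exact_mod_cast hs
    have hlt : (s : ℝ) < ((s + 1 : ℕ) : ℝ) := by push_cast; linarith
    obtain ⟨c, hc, hc'⟩ := exists_hasDerivAt_eq_slope (fun x : ℝ => x ^ (1 - γ))
      (fun x : ℝ => (1 - γ) * x ^ (1 - γ - 1)) hlt
      (fun x hx => (Real.continuousAt_rpow_const x _
        (Or.inl (hs0.trans_le hx.1).ne')).continuousWithinAt)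
      (fun x hx => Real.hasDerivAt_rpow_const (Or.inl (hs0.trans hx.1).ne'))
    rw [show ((s + 1 : ℕ) : ℝ) - s = 1 by push_cast; ring, div_one,
      show 1 - γ - 1 = -γ by ring] at hc'
    rw [le_div_iff₀ hγ1]
    have := Real.rpow_le_rpow_of_nonpos (hs0.trans hc.1) hc.2.le (show -γ ≤ 0 by linarith)
    nlinarith
  have key : ∀ n : ℕ, ∑ s ∈ Finset.Ico 1 (n + 2), (s : ℝ) ^ (-γ) ≤
      γ / (γ - 1) - ((n + 1 : ℕ) : ℝ) ^ (1 - γ) / (γ - 1) := by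
    intro n
    induction n with
    | zero =>
      have : γ / (γ - 1) - 1 / (γ - 1) = 1 := by field_simp
      simpa [one_div] using this.ge
    | succ n ih =>
      rw [Finset.sum_Ico_succ_top (by omega)]
      have := hstep (n + 1) (by omega)
      rw [sub_div] at this
      linarith
  calc ∑ s ∈ Finset.Ico 1 n, (s : ℝ) ^ (-γ) ≤ ∑ s ∈ Finset.Ico 1 (n + 2), (s : ℝ) ^ (-γ) :=
        Finset.sum_le_sum_of_subset_of_nonneg (Finset.Ico_subset_Ico_right (by omega))
          fun s _ _ => by positivity
    _ ≤ γ / (γ - 1) - ((n + 1 : ℕ) : ℝ) ^ (1 - γ) / (γ - 1) := key n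
    _ ≤ γ / (γ - 1) := sub_le_self _ (by positivity)

theorem log_mul_rpow_neg_le_half {γ x : ℝ} (hγ : 1 < γ) (hx : 1 ≤ x) :
    Real.log x * x ^ (-γ) ≤ 1 / 2 := by
  have hx0 : 0 < x := by linarith
  have h1 : x ^ (-γ) ≤ x⁻¹ := by
    rw [← Real.rpow_neg_one]
    exact Real.rpow_le_rpow_of_exponent_le hx (by linarith)
  have h2 : Real.log x ≤ x / 2 := by
    have := Real.log_le_sub_one_of_pos (show 0 < x / 2 by positivity)
    rw [Real.log_div hx0.ne' two_ne_zero] at this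
    linarith [Real.log_two_lt_d9]
  calc Real.log x * x ^ (-γ) ≤ x / 2 * x⁻¹ :=
        mul_le_mul h2 h1 (by positivity) (by positivity)
    _ = 1 / 2 := by field_simp

theorem sum_log_mul_rpow_neg_le {γ : ℝ} (hγ : 1 < γ) (n : ℕ) :
    ∑ s ∈ Finset.Ico 1 n, Real.log s * (s : ℝ) ^ (-γ) ≤ 1 / (γ - 1) ^ 2 + 1 := by
  have hγ1 : 0 < γ - 1 := sub_pos.mpr hγ
  -- `H x` is the integral of `log y * y^(-γ)` over `y ≥ x`.
  set H : ℝ → ℝ := fun x => (Real.log x / (γ - 1) + 1 / (γ - 1) ^ 2) * x ^ (1 - γ) with hH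
  have hderiv : ∀ x : ℝ, 0 < x → HasDerivAt H (-(Real.log x * x ^ (-γ))) x := by
    intro x hx
    have h1 := (((Real.hasDerivAt_log hx.ne').div_const (γ - 1)).add_const (1 / (γ - 1) ^ 2)).mul
      (Real.hasDerivAt_rpow_const (p := 1 - γ) (Or.inl hx.ne'))
    refine h1.congr_deriv ?_
    have h2 : x ^ (1 - γ) = x * x ^ (-γ) := by
      rw [sub_eq_add_neg, Real.rpow_add hx, Real.rpow_one]
    rw [show 1 - γ - 1 = -γ by ring, h2]
    field_simp
    ring
  have hHanti : ∀ x y : ℝ, 1 ≤ x → x ≤ y → H y ≤ H x := by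
    intro x y hx hxy
    refine antitoneOn_of_hasDerivWithinAt_nonpos (D := Set.Ici 1) (convex_Ici 1)
      (fun z hz => (hderiv z (by linarith [Set.mem_Ici.mp hz])).continuousAt.continuousWithinAt)
      (fun z hz => (hderiv z ?_).hasDerivWithinAt) (fun z hz => ?_) hx (hx.trans hxy) hxy
    · rw [interior_Ici] at hz
      linarith [Set.mem_Ioi.mp hz]
    · rw [interior_Ici] at hz
      have hz1 := Set.mem_Ioi.mp hz
      exact neg_nonpos.mpr (mul_nonneg (Real.log_nonneg hz1.le) (by positivity))
  -- The summand decreases only beyond `exp (1/γ) < e < 3`, so telescoping starts at 3. The term at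
  -- 1 is zero, and those at 2 and 3 are at most `1/2` each.
  have hstep : ∀ s : ℕ, 3 ≤ s → Real.log ((s + 1 : ℕ) : ℝ) * ((s + 1 : ℕ) : ℝ) ^ (-γ) ≤
      H s - H ((s + 1 : ℕ) : ℝ) := by
    intro s hs
    have hs3 : (3 : ℝ) ≤ s := by exact_mod_cast hs
    have hlt : (s : ℝ) < ((s + 1 : ℕ) : ℝ) := by push_cast; linarith
    obtain ⟨c, hc, hc'⟩ := exists_hasDerivAt_eq_slope H
      (fun x : ℝ => -(Real.log x * x ^ (-γ))) hlt
      (fun x hx => (hderiv x (by linarith [hx.1])).continuousAt.continuousWithinAt)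
      (fun x hx => hderiv x (by linarith [hx.1]))
    rw [show ((s + 1 : ℕ) : ℝ) - s = 1 by push_cast; ring, div_one] at hc'
    have hexp : Real.exp γ⁻¹ ≤ c := by
      have h1 : Real.exp γ⁻¹ ≤ Real.exp 1 := Real.exp_le_exp.mpr (inv_le_one_of_one_le₀ hγ.le)
      linarith [Real.exp_one_lt_d9, hc.1]
    have h2 := Real.log_div_self_rpow_antitoneOn (show 0 < γ by linarith)
      (Set.mem_Ici.mpr hexp) (Set.mem_Ici.mpr (hexp.trans hc.2.le)) hc.2.le
    have hc0 : 0 < c := by linarith [hc.1]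
    simp only [div_eq_mul_inv] at h2
    rw [← Real.rpow_neg hc0.le, ← Real.rpow_neg (Nat.cast_nonneg _)] at h2
    linarith
  have key : ∀ n : ℕ, ∑ s ∈ Finset.Ico 1 (n + 4), Real.log s * (s : ℝ) ^ (-γ) ≤
      1 + (H 3 - H ((n + 3 : ℕ) : ℝ)) := by
    intro n
    induction n with
    | zero =>
      have h2 := log_mul_rpow_neg_le_half hγ (show (1 : ℝ) ≤ 2 by norm_num)
      have h3 := log_mul_rpow_neg_le_half hγ (show (1 : ℝ) ≤ 3 by norm_num)
      simp only [zero_add, Finset.sum_Ico_succ_top (show 1 ≤ 3 by norm_num),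
        Finset.sum_Ico_succ_top (show 1 ≤ 2 by norm_num),
        Finset.sum_Ico_succ_top (show 1 ≤ 1 by norm_num), Finset.Ico_self, Finset.sum_empty]
      push_cast
      rw [Real.log_one]
      linarith
    | succ n ih =>
      rw [Finset.sum_Ico_succ_top (by omega)]
      have := hstep (n + 3) (by omega)
      have e : n + 1 + 3 = n + 3 + 1 := by omega
      rw [e]
      linarith
  have hH1 : H 1 = 1 / (γ - 1) ^ 2 := by simp [hH]
  have hH3 := hHanti 1 3 le_rfl (by norm_num)
  have hHn : 0 ≤ H ((n + 3 : ℕ) : ℝ) := by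
    have : 0 ≤ Real.log ((n + 3 : ℕ) : ℝ) := Real.log_natCast_nonneg _
    positivity
  calc ∑ s ∈ Finset.Ico 1 n, Real.log s * (s : ℝ) ^ (-γ)
      ≤ ∑ s ∈ Finset.Ico 1 (n + 4), Real.log s * (s : ℝ) ^ (-γ) :=
        Finset.sum_le_sum_of_subset_of_nonneg (Finset.Ico_subset_Ico_right (by omega))
          fun s _ _ => mul_nonneg (Real.log_natCast_nonneg _) (by positivity)
    _ ≤ 1 + (H 3 - H ((n + 3 : ℕ) : ℝ)) := key n
    _ ≤ _ := by linarith

theorem sum_deviation_le {γ η : ℝ} (hγ : 1 < γ) (hη : 0 < η) (n : ℕ) :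
    ∑ s ∈ Finset.Ico 1 n, 2 * ((Real.log s / Real.log (1 + η) + 1) * (s : ℝ) ^ (-γ)) ≤
      2 / Real.log (1 + η) *
        (1 / (γ - 1) ^ 2 + γ * Real.log (1 + η) / (γ - 1) + 1) := by
  have hlog : 0 < Real.log (1 + η) := Real.log_pos (by linarith)
  have h1 := sum_rpow_neg_le hγ n
  have h2 := sum_log_mul_rpow_neg_le hγ n
  calc ∑ s ∈ Finset.Ico 1 n, 2 * ((Real.log s / Real.log (1 + η) + 1) * (s : ℝ) ^ (-γ))
      = 2 / Real.log (1 + η) * (∑ s ∈ Finset.Ico 1 n, Real.log s * (s : ℝ) ^ (-γ) +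
          Real.log (1 + η) * ∑ s ∈ Finset.Ico 1 n, (s : ℝ) ^ (-γ)) := by
        rw [Finset.mul_sum, ← Finset.sum_add_distrib, Finset.mul_sum]
        refine Finset.sum_congr rfl fun s _ => ?_
        field_simp
    _ ≤ 2 / Real.log (1 + η) * ((1 / (γ - 1) ^ 2 + 1) +
          Real.log (1 + η) * (γ / (γ - 1))) := by gcongr
    _ = _ := by ring

theorem le_reachTime {f : ℝ → ℝ} (hf : MonotoneOn f (Set.Ici 1)) {ε : ℝ}
    (hreach : ∃ t, 1 ≤ t ∧ ε ≤ f t) {s : ℝ} (hs : 1 ≤ s) (hlt : f s < ε) :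
    s ≤ reachTime f ε := by
  refine le_csInf hreach fun t ht => ?_
  by_contra! h
  have := hf (Set.mem_Ici.mpr ht.1) (Set.mem_Ici.mpr hs) h.le
  linarith [ht.2]

theorem one_le_reachTime {f : ℝ → ℝ} {ε : ℝ} (hreach : ∃ t, 1 ≤ t ∧ ε ≤ f t) :
    1 ≤ reachTime f ε :=
  le_csInf hreach fun _ ht => ht.1

theorem sum_agent_le {γ η : ℝ} (hγ : 1 < γ) (hη : 0 < η) {f : ℝ → ℝ}
    (hf : MonotoneOn f (Set.Ici 1)) {ε : ℝ} (hreach : ∃ t, 1 ≤ t ∧ ε ≤ f t) {n₀ : ℕ}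
    (hn₀ : 1 ≤ n₀) (n : ℕ) {b : ℕ → ℝ} (hb1 : ∀ s, b s ≤ 1)
    (hb : ∀ s ∈ Finset.Ico n₀ n, ε ≤ f s →
      b s ≤ 2 * ((Real.log s / Real.log (1 + η) + 1) * (s : ℝ) ^ (-γ))) :
    ∑ s ∈ Finset.Ico n₀ n, b s ≤ (reachTime f ε - 1) + 2 / Real.log (1 + η) *
        (1 / (γ - 1) ^ 2 + γ * Real.log (1 + η) / (γ - 1) + 1) := by
  have hlog : 0 < Real.log (1 + η) := Real.log_pos (by linarith)
  set h : ℕ → ℝ := fun s => 2 * ((Real.log s / Real.log (1 + η) + 1) * (s : ℝ) ^ (-γ)) with hh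
  have hh0 : ∀ s, 0 ≤ h s := fun s => by
    have := Real.log_natCast_nonneg s
    positivity
  -- Time 1 needs no separate charge, since `h 1 = 2` already exceeds any probability. The remaining
  -- early times lie between 2 and `t_k†`, which gives `t_k† - 1` rather than `t_k†`.
  have hpt : ∀ s ∈ Finset.Ico n₀ n, b s ≤ (if 2 ≤ s ∧ f s < ε then 1 else 0) + h s := by
    intro s hs
    by_cases hbad : 2 ≤ s ∧ f s < ε
    · rw [if_pos hbad]
      linarith [hb1 s, hh0 s]
    · rw [if_neg hbad, zero_add]
      by_cases hs2 : 2 ≤ s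
      · exact hb s hs (not_lt.mp fun hc => hbad ⟨hs2, hc⟩)
      · have hs1 : s = 1 := by
          have := (Finset.mem_Ico.mp hs).1
          omega
        have : h 1 = 2 := by simp [hh]
        rw [hs1, this]
        linarith [hb1 1]
  have hcard : ∑ s ∈ Finset.Ico n₀ n, (if 2 ≤ s ∧ f s < ε then (1 : ℝ) else 0) ≤
      reachTime f ε - 1 := by
    have h1 := one_le_reachTime hreach
    rw [← Finset.sum_filter, Finset.sum_const, nsmul_eq_mul, mul_one]
    have hsub : (Finset.Ico n₀ n).filter (fun s : ℕ => 2 ≤ s ∧ f s < ε) ⊆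
        Finset.Icc 2 ⌊reachTime f ε⌋₊ := by
      intro s hs
      obtain ⟨_, hs2, hs3⟩ := Finset.mem_filter.mp hs
      have : (1 : ℝ) ≤ s := by exact_mod_cast (by omega : 1 ≤ s)
      exact Finset.mem_Icc.mpr ⟨hs2, Nat.le_floor (le_reachTime hf hreach this hs3)⟩
    have hfl : 1 ≤ ⌊reachTime f ε⌋₊ := Nat.le_floor (by simpa using h1)
    have h2 := Finset.card_le_card hsub
    rw [Nat.card_Icc] at h2
    have h3 : ((Finset.Ico n₀ n).filter (fun s : ℕ => 2 ≤ s ∧ f s < ε)).card + 1 ≤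
        ⌊reachTime f ε⌋₊ := by omega
    have h4 : ((((Finset.Ico n₀ n).filter (fun s : ℕ => 2 ≤ s ∧ f s < ε)).card + 1 : ℕ) : ℝ) ≤
        reachTime f ε := (Nat.cast_le.mpr h3).trans (Nat.floor_le (by linarith))
    push_cast at h4
    linarith
  calc ∑ s ∈ Finset.Ico n₀ n, b s
      ≤ ∑ s ∈ Finset.Ico n₀ n, ((if 2 ≤ s ∧ f s < ε then 1 else 0) + h s) :=
        Finset.sum_le_sum hpt
    _ ≤ (reachTime f ε - 1) + ∑ s ∈ Finset.Ico 1 n, h s := by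
        rw [Finset.sum_add_distrib]
        exact add_le_add hcard (Finset.sum_le_sum_of_subset_of_nonneg
          (Finset.Ico_subset_Ico_left hn₀) fun s _ _ => hh0 s)
    _ ≤ _ := by
        gcongr
        exact sum_deviation_le hγ hη n

/-! ### The exploration term -/

/-- Clearing the denominator `n̂` in an index inequality leaves exactly the normalization `√((n̂ +
f)/M)` of the deviation bound. -/
theorem mul_explore {M : ℕ} (σ γ η : ℝ) (f : ℝ → ℝ) {t : ℕ} {n : ℝ} (hn : 0 < n)
    (hc : 0 ≤ 2 * γ * Real.log t / gFun η) :
    n * explore M σ γ η f t n = σ * √(2 * γ * Real.log t / gFun η) * √((n + f t) / M) := by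
  rw [explore, mul_assoc σ, ← Real.sqrt_mul hc, mul_left_comm]
  congr 1
  conv_lhs => rw [← Real.sqrt_sq hn.le, ← Real.sqrt_mul (sq_nonneg n)]
  congr 1
  rw [Real.sqrt_sq hn.le]
  field_simp

/-- The number of selections of a suboptimal arm with gap `Δ` after which the exploration term of
every agent is at most `Δ / 2`. -/
noncomputable def selThreshold (M : ℕ) (σ γ η : ℝ) (f : ℝ → ℝ) (T : ℕ) (Δ : ℝ) : ℝ :=
  4 * σ ^ 2 * γ * Real.log T / (Δ ^ 2 * gFun η) *
    (1 + √(1 + Δ ^ 2 * M * gFun η / (2 * γ * σ ^ 2) * (f T / Real.log T)))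

theorem two_mul_explore_le {M : ℕ} (hM : 0 < M) {σ γ η : ℝ} (hσ : 0 < σ) (hγ : 0 < γ)
    (hG : 0 < gFun η) {f : ℝ → ℝ} (hf0 : ∀ t, 1 ≤ t → 0 ≤ f t) (hf : MonotoneOn f (Set.Ici 1))
    {s T : ℕ} (hs : 1 ≤ s) (hsT : s < T) {Δ n : ℝ} (hΔ : 0 < Δ)
    (hn : selThreshold M σ γ η f T Δ / M ≤ n) (hn0 : 0 < n) :
    2 * explore M σ γ η f s n ≤ Δ := by
  have hM' : (0 : ℝ) < M := by exact_mod_cast hM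
  have hs1 : (1 : ℝ) ≤ s := by exact_mod_cast hs
  have hsT' : (s : ℝ) < T := by exact_mod_cast hsT
  -- Since `T > s ≥ 1`, the division by `log T` in the threshold is genuine.
  have hlogT : 0 < Real.log T := Real.log_pos (by linarith)
  have hlogs : 0 ≤ Real.log s := Real.log_nonneg hs1
  have hlogle : Real.log s ≤ Real.log T := Real.log_le_log (by linarith) hsT'.le
  have hfs := hf0 s hs1
  have hfT := hf0 T (by linarith)
  have hfle : f s ≤ f T := hf (Set.mem_Ici.mpr hs1) (Set.mem_Ici.mpr (by linarith)) hsT'.le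
  -- With `s` replaced by `T` inside `f` and the logarithm, the requirement becomes `b (n + f T) ≤
  -- n²`; the threshold divided by `M` is the positive root of this quadratic.
  set b : ℝ := 8 * σ ^ 2 * γ * Real.log T / (gFun η * M * Δ ^ 2) with hb
  have hb0 : 0 < b := by positivity
  have hthr : selThreshold M σ γ η f T Δ / M = b / 2 + √(b ^ 2 / 4 + b * f T) := by
    have e1 : b ^ 2 / 4 + b * f T =
        (b / 2) ^ 2 * (1 + Δ ^ 2 * M * gFun η / (2 * γ * σ ^ 2) * (f T / Real.log T)) := by
      rw [hb]
      field_simp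
      ring
    rw [e1, Real.sqrt_mul (sq_nonneg _), Real.sqrt_sq (by positivity), selThreshold, hb]
    field_simp
    ring
  rw [hthr] at hn
  have hsq : b * (n + f T) ≤ n ^ 2 := by
    have h1 : √(b ^ 2 / 4 + b * f T) ≤ n - b / 2 := by linarith
    have h2 := Real.sq_sqrt (show 0 ≤ b ^ 2 / 4 + b * f T by positivity)
    have h3 := mul_self_le_mul_self (Real.sqrt_nonneg _) h1
    nlinarith
  have hmain : 4 * σ ^ 2 * (2 * γ / gFun η * ((n + f s) / (M * n)) * (Real.log s / n)) ≤
      Δ ^ 2 := by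
    calc 4 * σ ^ 2 * (2 * γ / gFun η * ((n + f s) / (M * n)) * (Real.log s / n))
        ≤ 4 * σ ^ 2 * (2 * γ / gFun η * ((n + f T) / (M * n)) * (Real.log T / n)) := by
          gcongr
      _ = Δ ^ 2 * (b * (n + f T)) / n ^ 2 := by
          rw [hb]
          field_simp
          ring
      _ ≤ Δ ^ 2 := by
          rw [div_le_iff₀ (by positivity)]
          gcongr
  rw [explore, ← mul_assoc]
  refine le_of_sq_le_sq ?_ hΔ.le
  rw [mul_pow, Real.sq_sqrt (by positivity)]
  linarith

/-! ### Counting selections along one realization -/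

/-- Terms added while the running total is at most `A` can overshoot `A` only once, and by at most
one term. -/
theorem sum_le_add_sum_above {x : ℕ → ℝ} {A B : ℝ} (hA : 0 ≤ A) (hB : 0 ≤ B)
    (hxB : ∀ s, x s ≤ B) (hx0 : ∀ s, 0 ≤ x s) (T : ℕ) :
    ∑ s ∈ Finset.range T, x s ≤ A + B +
      ∑ s ∈ Finset.range T, if A < ∑ j ∈ Finset.range s, x j then x s else 0 := by
  have key : ∀ T : ℕ,
      ∑ s ∈ Finset.range T, (if A < ∑ j ∈ Finset.range s, x j then 0 else x s) ≤
        ∑ s ∈ Finset.range T, x s ∧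
      ∑ s ∈ Finset.range T, (if A < ∑ j ∈ Finset.range s, x j then 0 else x s) ≤ A + B := by
    intro T
    induction T with
    | zero => simpa using add_nonneg hA hB
    | succ T ih =>
      rw [Finset.sum_range_succ, Finset.sum_range_succ]
      split_ifs with h
      · exact ⟨by linarith [ih.1, hx0 T], by linarith [ih.2]⟩
      · exact ⟨by linarith [ih.1], by linarith [ih.1, hxB T]⟩
  have hsplit : ∑ s ∈ Finset.range T, x s =
      ∑ s ∈ Finset.range T, (if A < ∑ j ∈ Finset.range s, x j then 0 else x s) +
      ∑ s ∈ Finset.range T, (if A < ∑ j ∈ Finset.range s, x j then x s else 0) := by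
    rw [← Finset.sum_add_distrib]
    exact Finset.sum_congr rfl fun s _ => by split_ifs <;> simp
  rw [hsplit]
  gcongr
  exact (key T).2

theorem selCount_le {M N : ℕ} {a : ℕ → Fin M → Fin N}
    (hinit : ∀ (i : Fin N) (k : Fin M), a (i.val + 1) k = i) (i : Fin N) {A : ℝ} (hA : 0 ≤ A)
    (T : ℕ) :
    selCount a i T ≤ A + M + ∑ s ∈ Finset.Ico N T, ∑ d,
      if a (s + 1) d = i ∧ A < selCount a i s then 1 else 0 := by
  have h := sum_le_add_sum_above (x := fun s => ∑ d, if a (s + 1) d = i then (1 : ℝ) else 0)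
    (B := M) hA (Nat.cast_nonneg _)
    (fun s => (Finset.sum_le_sum fun d _ => (by split_ifs <;> norm_num :
      (if a (s + 1) d = i then (1 : ℝ) else 0) ≤ 1)).trans (by simp))
    (fun s => Finset.sum_nonneg fun d _ => by split_ifs <;> norm_num) T
  refine h.trans (add_le_add le_rfl ?_)
  -- During initialization the arm is selected only at time `i + 1`, when its count is still zero;
  -- with `A ≥ 0` no selection before time `N + 1` is charged.
  have hzero : ∀ s ≤ i.val, selCount a i s = 0 := by
    intro s hs
    refine Finset.sum_eq_zero fun j hj => Finset.sum_eq_zero fun d _ => ?_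
    have hj' := Finset.mem_range.mp hj
    have hjN : j < N := by omega
    have := hinit ⟨j, hjN⟩ d
    rw [if_neg]
    intro hc
    rw [this] at hc
    have := congrArg Fin.val hc
    simp only at this
    omega
  set y : ℕ → ℝ := fun s => ∑ d, if a (s + 1) d = i ∧ A < selCount a i s then (1 : ℝ) else 0
  have hy0 : ∀ s, 0 ≤ y s := fun s => Finset.sum_nonneg fun d _ => by split_ifs <;> norm_num
  have hyN : ∀ s < N, y s = 0 := by
    intro s hs
    refine Finset.sum_eq_zero fun d _ => if_neg ?_
    rintro ⟨h1, h2⟩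
    have h3 := hinit ⟨s, hs⟩ d
    rw [h1] at h3
    rw [hzero s (by rw [h3])] at h2
    linarith
  calc _ = ∑ s ∈ Finset.range T, y s := by
        refine Finset.sum_congr rfl fun s _ => ?_
        change (if A < selCount a i s then _ else _) = _
        split_ifs with hc <;> simp [y, hc]
    _ ≤ ∑ s ∈ Finset.Ico N T, y s := by
        rw [← Finset.sum_filter_add_sum_filter_not (Finset.range T) (fun s => s < N)]
        rw [Finset.sum_eq_zero fun s hs => hyN s (Finset.mem_filter.mp hs).2, zero_add]
        refine Finset.sum_le_sum_of_subset_of_nonneg (fun s hs => ?_) fun s _ _ => hy0 s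
        have h1 := Finset.mem_filter.mp hs
        exact Finset.mem_Ico.mpr ⟨not_lt.mp h1.2, Finset.mem_range.mp h1.1⟩

theorem selCount_nonneg {M N : ℕ} (a : ℕ → Fin M → Fin N) (i : Fin N) (T : ℕ) :
    0 ≤ selCount a i T :=
  Finset.sum_nonneg fun _ _ => Finset.sum_nonneg fun _ _ => by split_ifs <;> norm_num

theorem selCount_le_mul {M N : ℕ} (a : ℕ → Fin M → Fin N) (i : Fin N) (T : ℕ) :
    selCount a i T ≤ T * M := by
  refine (Finset.sum_le_sum fun s _ => Finset.sum_le_sum fun d _ =>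
    (by split_ifs <;> norm_num : (if a (s + 1) d = i then (1 : ℝ) else 0) ≤ 1)).trans ?_
  simp

theorem regret_eq_sum_gap_mul_selCount {M N : ℕ} (m : Fin N → ℝ) (a : ℕ → Fin M → Fin N)
    (T : ℕ) : (M : ℝ) * T * (⨆ j, m j) - ∑ t ∈ Finset.Icc 1 T, ∑ k, m (a t k) =
      ∑ i, gap m i * selCount a i T := by
  have h1 : ∑ t ∈ Finset.Icc 1 T, ∑ k, m (a t k) = ∑ s ∈ Finset.range T, ∑ k, m (a (s + 1) k) := by
    rw [Finset.range_eq_Ico, Finset.sum_Ico_add' (fun t => ∑ k, m (a t k)) 0 T 1]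
    rfl
  have h2 : (M : ℝ) * T * (⨆ j, m j) = ∑ s ∈ Finset.range T, ∑ k : Fin M, ⨆ j, m j := by
    simp
    ring
  rw [h1, h2, ← Finset.sum_sub_distrib]
  simp only [selCount, Finset.mul_sum]
  rw [Finset.sum_comm]
  refine Finset.sum_congr rfl fun s _ => ?_
  rw [← Finset.sum_sub_distrib, Finset.sum_comm]
  refine Finset.sum_congr rfl fun k _ => ?_
  simp [gap]

/-! ### Deviation probabilities of the consensus estimates -/

/-- `P` is a symmetric stochastic matrix with an ordered orthonormal eigenbasis, the first
eigenvector being constant and all other eigenvalues having modulus less than one. -/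
structure IsMixing {M : ℕ} (P : Matrix (Fin M) (Fin M) ℝ) (lam : Fin M → ℝ)
    (u : Fin M → Fin M → ℝ) : Prop where
  basis : IsOrderedEigenbasis P lam u
  nonneg : ∀ k d, 0 ≤ P k d
  mulVec_one : P *ᵥ (fun _ => 1) = fun _ => 1
  lam_first : ∀ z : Fin M, z.val = 0 → lam z = 1
  first_mul : ∀ z : Fin M, z.val = 0 → ∀ k d, u z k * u z d = 1 / M
  abs_lam_lt : ∀ p : Fin M, 0 < p.val → |lam p| < 1

theorem isMixing_consensusMatrix {M : ℕ} {G : SimpleGraph (Fin M)} [DecidableRel G.Adj]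
    (hG : G.Connected) {κ : ℝ} (hκ : κ ∈ Set.Ioc (0 : ℝ) 1)
    {lam : Fin M → ℝ} {u : Fin M → Fin M → ℝ}
    (h : IsOrderedEigenbasis (consensusMatrix G κ) lam u) (hgt : ∀ p, -1 < lam p) :
    IsMixing (consensusMatrix G κ) lam u where
  basis := h
  nonneg := consensusMatrix_nonneg G hκ
  mulVec_one := consensusMatrix_mulVec_one G κ
  lam_first _ := lam_first_eq_one hκ h
  first_mul _ := first_eigenvector_mul hG hκ h
  abs_lam_lt _ := abs_lam_lt_one hG hκ h hgt

theorem IsCoopUCB2.measurable {M N : ℕ} {Ω : Type*} [MeasurableSpace Ω] {μ : Measure Ω}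
    {p : Fin N → Measure ℝ} {r : ℕ → Fin M → Fin N → Ω → ℝ} (hr : IsRewardProcess μ p r)
    {P : Matrix (Fin M) (Fin M) ℝ} {σ γ η : ℝ} {f : ℝ → ℝ} {arm : ℕ → Fin M → Ω → Fin N}
    (harm : IsCoopUCB2 P σ γ η f r arm) (s : ℕ) (d : Fin M) : Measurable (arm (s + 1) d) :=
  (harm.previsible (s + 1) (by omega) d).mono (pastRewards_le hr _) le_rfl

theorem measurable_selected_sum {M N : ℕ} {Ω : Type*} [MeasurableSpace Ω]
    {arm : ℕ → Fin M → Ω → Fin N} (harm : ∀ s d, Measurable (arm (s + 1) d)) (i : Fin N)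
    (w : ℕ → Fin M → ℝ) {x : ℕ → Fin M → Ω → ℝ} (hx : ∀ s d, Measurable (x s d)) (t : ℕ) :
    Measurable fun ω => ∑ s ∈ Finset.range t, ∑ d,
      w s d * (if arm (s + 1) d ω = i then x s d ω else 0) :=
  Finset.measurable_fun_sum _ fun s _ => Finset.measurable_fun_sum _ fun d _ =>
    (Measurable.ite (harm s d (MeasurableSet.singleton i)) (hx s d) measurable_const).const_mul _

theorem measurable_selCount {M N : ℕ} {Ω : Type*} [MeasurableSpace Ω]
    {arm : ℕ → Fin M → Ω → Fin N} (harm : ∀ s d, Measurable (arm (s + 1) d)) (i : Fin N)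
    (t : ℕ) : Measurable fun ω => selCount (fun s j => arm s j ω) i t := by
  simpa [selCount] using measurable_selected_sum harm i (fun _ _ => 1) (x := fun _ _ _ => 1)
    (fun _ _ => measurable_const) t

/-- The half-width of the confidence interval, relative to the square root of the variance
bound. -/
noncomputable def confWidth (σ γ η : ℝ) (t : ℕ) : ℝ := σ * √(2 * γ * Real.log t / gFun η)

/-- Peeling applies with ratio `t` because `1 ≤ n̂ ≤ t`, and the confidence width makes the exponent
equal to `γ log t`. The sign `c` covers both tails. -/
theorem deviation_le {M N : ℕ} {Ω : Type*} [MeasurableSpace Ω] {μ : Measure Ω}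
    [IsProbabilityMeasure μ] {P : Matrix (Fin M) (Fin M) ℝ} {lam : Fin M → ℝ}
    {u : Fin M → Fin M → ℝ} (hP : IsMixing P lam u)
    {σ γ η : ℝ} (hσ : 0 < σ) (hγ : 1 < γ) (hη : η ∈ Set.Ioo (0 : ℝ) 4)
    {f : ℝ → ℝ} (hf0 : ∀ t, 1 ≤ t → 0 ≤ f t)
    {p : Fin N → Measure ℝ} (hp : ∀ i, IsSubGaussian (p i) σ)
    {r : ℕ → Fin M → Fin N → Ω → ℝ} (hr : IsRewardProcess μ p r)
    {arm : ℕ → Fin M → Ω → Fin N} (harm : IsCoopUCB2 P σ γ η f r arm)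
    {t : ℕ} (ht : N ≤ t) {k : Fin M} (hk : epsC lam u k ≤ f t) (i : Fin N) {c : ℝ}
    (hc : c ^ 2 = 1) :
    μ.real {ω | confWidth σ γ η t * √((nHat P (fun s j => arm s j ω) i t k + f t) / M) ≤
      c * (sHat P (fun s j => arm s j ω) (fun s j l => r s j l ω) i t k
        - (∫ x, x ∂(p i)) * nHat P (fun s j => arm s j ω) i t k)} ≤
      (Real.log t / Real.log (1 + η) + 1) * (t : ℝ) ^ (-γ) := by
  have hM : (0 : ℝ) < M := by exact_mod_cast k.pos
  have ht1 : 1 ≤ t := by have := i.pos; omega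
  have ht1' : (1 : ℝ) ≤ t := by exact_mod_cast ht1
  have hlog : 0 ≤ Real.log t := Real.log_nonneg ht1'
  have hG := gFun_pos hη
  have hft := hf0 t ht1'
  have hmeas := harm.measurable hr
  have hS : Measurable fun ω => c * (sHat P (fun s j => arm s j ω) (fun s j l => r s j l ω) i t k
        - (∫ x, x ∂(p i)) * nHat P (fun s j => arm s j ω) i t k) := by
    simp only [sHat_eq_sum, nHat_eq_sum]
    exact ((measurable_selected_sum hmeas i (fun s d => (P ^ (t - s)) k d)
      (fun s d => hr.measurable (s + 1) d i) t).sub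
      ((measurable_selected_sum hmeas i (fun s d => (P ^ (t - s)) k d)
      (x := fun _ _ _ => 1) (fun _ _ => measurable_const) t).const_mul _)).const_mul c
  have hV : Measurable fun ω => varProxy P (fun s j => arm s j ω) i t k :=
    measurable_selected_sum hmeas i (fun s d => (P ^ (t - s)) k d ^ 2)
      (x := fun _ _ _ => 1) (fun _ _ => measurable_const) t
  have hδ : 0 ≤ confWidth σ γ η t := by
    rw [confWidth]
    positivity
  have h := measureReal_self_normalized_le (μ := μ) hS hV hσ hη.1 (fun θ => ?_)
    (W := fun ω => (nHat P (fun s j => arm s j ω) i t k + f t) / M) (fun ω => ?_)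
    (δ := confWidth σ γ η t) (A := (1 + f t) / M) (τ := t) hδ (by positivity) ht1'
    (fun ω => ?_) (fun ω => ?_)
  · refine h.trans (le_of_eq ?_)
    congr 1
    rw [Real.rpow_def_of_pos (by linarith), confWidth, mul_pow, Real.sq_sqrt (by positivity)]
    congr 1
    field_simp
  · refine le_trans (le_of_eq (lintegral_congr fun ω => ?_))
      (lintegral_exp_estimation_error_le_one hp hr harm.previsible P i t k (θ * c))
    rw [mul_pow, hc, mul_one, mul_assoc]
  · let z : Fin M := ⟨0, k.pos⟩
    refine (varProxy_le hP.basis (z := z) rfl (hP.lam_first z rfl) (hP.first_mul z rfl)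
      hP.abs_lam_lt _ i t k).trans ?_
    gcongr
  · gcongr
    exact one_le_nHat hP.nonneg hP.mulVec_one (fun k => harm.init i k ω) (by omega) k
  · have h1 := nHat_le hP.nonneg hP.mulVec_one (fun s j => arm s j ω) i t k
    rw [div_mul_eq_mul_div]
    gcongr
    nlinarith

/-! ### Expected number of selections of a suboptimal arm -/

/-- Optimism: if both confidence bounds held, then `m j < Q_j ≤ Q_i < m i + 2 C_i ≤ m i + Δ_i = m
j`, a contradiction. -/
theorem selected_subset_deviation {M N : ℕ} {Ω : Type*}
    {P : Matrix (Fin M) (Fin M) ℝ} {lam : Fin M → ℝ}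
    {u : Fin M → Fin M → ℝ} (hP : IsMixing P lam u)
    {σ γ η : ℝ} (hσ : 0 < σ) (hγ : 1 < γ) (hη : η ∈ Set.Ioo (0 : ℝ) 4)
    {f : ℝ → ℝ} (hf0 : ∀ t, 1 ≤ t → 0 ≤ f t) (hf : MonotoneOn f (Set.Ici 1))
    {r : ℕ → Fin M → Fin N → Ω → ℝ}
    {arm : ℕ → Fin M → Ω → Fin N} (harm : IsCoopUCB2 P σ γ η f r arm) {m : Fin N → ℝ}
    {i j : Fin N} (hj : m j = ⨆ l, m l) (hi : 0 < gap m i)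
    {s T : ℕ} (hs : N ≤ s) (hsT : s < T) (k : Fin M) :
    {ω | arm (s + 1) k ω = i ∧ selThreshold M σ γ η f T (gap m i) + M * epsN lam <
        selCount (fun s j => arm s j ω) i s} ⊆
      {ω | confWidth σ γ η s * √((nHat P (fun s j => arm s j ω) i s k + f s) / M) ≤
        1 * (sHat P (fun s j => arm s j ω) (fun s j l => r s j l ω) i s k
          - m i * nHat P (fun s j => arm s j ω) i s k)} ∪
      {ω | confWidth σ γ η s * √((nHat P (fun s j => arm s j ω) j s k + f s) / M) ≤
        (-1) * (sHat P (fun s j => arm s j ω) (fun s j l => r s j l ω) j s k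
          - m j * nHat P (fun s j => arm s j ω) j s k)} := by
  rintro ω ⟨hsel, hcount⟩
  by_contra hcon
  simp only [Set.mem_union, Set.mem_ofPred_eq, not_or, not_le] at hcon
  obtain ⟨hc1, hc2⟩ := hcon
  have hM : (0 : ℝ) < M := by exact_mod_cast k.pos
  have hs1 : 1 ≤ s := by have := i.pos; omega
  have hlog : 0 ≤ Real.log s := Real.log_natCast_nonneg s
  have hG := gFun_pos hη
  have hnn : ∀ l, 1 ≤ nHat P (fun s j => arm s j ω) l s k := fun l =>
    one_le_nHat hP.nonneg hP.mulVec_one (fun k => harm.init l k ω) (by omega) k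
  have hq := harm.select s hs k ω j
  rw [hsel, qIndex, qIndex] at hq
  have hle : selThreshold M σ γ η f T (gap m i) / M ≤ nHat P (fun s j => arm s j ω) i s k := by
    let z : Fin M := ⟨0, k.pos⟩
    have h1 := selCount_div_sub_epsN_le_nHat hP.basis (z := z) rfl (hP.lam_first z rfl)
      (hP.first_mul z rfl) hP.abs_lam_lt (fun s j => arm s j ω) i s k
    refine le_trans ?_ h1
    rw [le_sub_iff_add_le, div_add' _ _ _ hM.ne']
    gcongr
    linarith
  set ni := nHat P (fun s j => arm s j ω) i s k
  set nj := nHat P (fun s j => arm s j ω) j s k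
  set si := sHat P (fun s j => arm s j ω) (fun s j l => r s j l ω) i s k
  set sj := sHat P (fun s j => arm s j ω) (fun s j l => r s j l ω) j s k
  have hni : 0 < ni := by linarith [hnn i]
  have hnj : 0 < nj := by linarith [hnn j]
  have hnonneg : 0 ≤ 2 * γ * Real.log s / gFun η := by positivity
  have hexp := two_mul_explore_le (n := ni) k.pos hσ (by linarith : 0 < γ) hG hf0 hf hs1 hsT hi
    hle hni
  rw [confWidth, ← mul_explore σ γ η f hni hnonneg] at hc1
  rw [confWidth, ← mul_explore σ γ η f hnj hnonneg] at hc2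
  have h1 : si / ni < m i + explore M σ γ η f s ni := by
    rw [div_lt_iff₀ hni]
    linarith
  have h2 : m j - explore M σ γ η f s nj < sj / nj := by
    rw [lt_div_iff₀ hnj]
    linarith
  have h3 : gap m i = m j - m i := by rw [gap, hj]
  linarith

theorem integral_selCount_le {M N : ℕ} {Ω : Type*} [MeasurableSpace Ω] {μ : Measure Ω}
    [IsProbabilityMeasure μ] {P : Matrix (Fin M) (Fin M) ℝ} {lam : Fin M → ℝ}
    {u : Fin M → Fin M → ℝ} (hP : IsMixing P lam u)
    {σ γ η : ℝ} (hσ : 0 < σ) (hγ : 1 < γ) (hη : η ∈ Set.Ioo (0 : ℝ) 4)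
    {f : ℝ → ℝ} (hf0 : ∀ t, 1 ≤ t → 0 ≤ f t) (hf : MonotoneOn f (Set.Ici 1))
    (hreach : ∀ k, ∃ t, 1 ≤ t ∧ epsC lam u k ≤ f t)
    {p : Fin N → Measure ℝ} (hp : ∀ i, IsSubGaussian (p i) σ)
    {m : Fin N → ℝ} (hm : ∀ i, m i = ∫ x, x ∂(p i))
    {r : ℕ → Fin M → Fin N → Ω → ℝ} (hr : IsRewardProcess μ p r)
    {arm : ℕ → Fin M → Ω → Fin N} (harm : IsCoopUCB2 P σ γ η f r arm)
    {i : Fin N} (hi : 0 < gap m i) (T : ℕ) :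
    ∫ ω, selCount (fun s j => arm s j ω) i T ∂μ ≤
      selThreshold M σ γ η f T (gap m i) + constL γ η f (epsN lam) (epsC lam u) := by
  have hG := gFun_pos hη
  have hεn := epsN_nonneg hP.abs_lam_lt
  have hmeas := harm.measurable hr
  have hlogη : 0 < Real.log (1 + η) := Real.log_pos (by linarith [hη.1])
  have hN : 1 ≤ N := i.pos
  have : Nonempty (Fin N) := ⟨i⟩
  obtain ⟨j, hj⟩ := exists_eq_ciSup_of_finite (f := m)
  set A := selThreshold M σ γ η f T (gap m i) + M * epsN lam with hA
  have hA0 : 0 ≤ A := by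
    have : 0 ≤ Real.log T := Real.log_natCast_nonneg T
    have : 0 ≤ selThreshold M σ γ η f T (gap m i) := by
      rw [selThreshold]
      positivity
    positivity
  set B : ℕ → Fin M → Set Ω := fun s k =>
    {ω | arm (s + 1) k ω = i ∧ A < selCount (fun s j => arm s j ω) i s} with hB
  have hBm : ∀ s k, MeasurableSet (B s k) := fun s k =>
    (hmeas s k (MeasurableSet.singleton i)).inter
      (measurableSet_lt measurable_const (measurable_selCount hmeas i s))
  have hBsum : ∀ k, ∑ s ∈ Finset.Ico N T, μ.real (B s k) ≤
      (reachTime f (epsC lam u k) - 1) + 2 / Real.log (1 + η) *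
        (1 / (γ - 1) ^ 2 + γ * Real.log (1 + η) / (γ - 1) + 1) := by
    intro k
    refine sum_agent_le hγ hη.1 hf (hreach k) hN T (fun s => measureReal_le_one) ?_
    intro s hs hk
    obtain ⟨hs1, hs2⟩ := Finset.mem_Ico.mp hs
    have hsub := selected_subset_deviation hP hσ hγ hη hf0 hf harm hj hi hs1 hs2 k
    refine (measureReal_mono hsub).trans ((measureReal_union_le _ _).trans ?_)
    have h1 := deviation_le hP hσ hγ hη hf0 hp hr harm hs1 hk i (c := 1) (by norm_num)
    have h2 := deviation_le hP hσ hγ hη hf0 hp hr harm hs1 hk j (c := -1) (by norm_num)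
    rw [← hm] at h1 h2
    linarith
  have hpt : ∀ ω, selCount (fun s j => arm s j ω) i T ≤
      A + M + ∑ s ∈ Finset.Ico N T, ∑ k, (B s k).indicator (fun _ => (1 : ℝ)) ω := fun ω => by
    refine (selCount_le (fun i k => harm.init i k ω) i hA0 T).trans (le_of_eq ?_)
    congr 1
    refine Finset.sum_congr rfl fun s _ => Finset.sum_congr rfl fun k _ => ?_
    simp [B, Set.indicator_apply]
  have hind : ∀ s k, Integrable ((B s k).indicator (fun _ => (1 : ℝ))) μ := fun s k =>
    (integrable_const 1).indicator (hBm s k)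
  have hint : Integrable (fun ω => selCount (fun s j => arm s j ω) i T) μ :=
    Integrable.of_bound (measurable_selCount hmeas i T).aestronglyMeasurable (T * M)
      (ae_of_all _ fun ω => by
        rw [Real.norm_of_nonneg (selCount_nonneg _ _ _)]
        exact selCount_le_mul _ _ _)
  have hint2 : Integrable (fun ω => ∑ s ∈ Finset.Ico N T, ∑ k,
      (B s k).indicator (fun _ => (1 : ℝ)) ω) μ :=
    integrable_finsetSum _ fun s _ => integrable_finsetSum _ fun k _ => hind s k
  have hE : ∫ ω, selCount (fun s j => arm s j ω) i T ∂μ ≤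
      A + M + ∑ k, ∑ s ∈ Finset.Ico N T, μ.real (B s k) := by
    refine (integral_mono hint ((integrable_const (A + M)).add hint2) hpt).trans (le_of_eq ?_)
    simp only [Pi.add_apply]
    rw [integral_add (integrable_const _) hint2,
      integral_finsetSum _ fun s _ => integrable_finsetSum _ fun k _ => hind s k,
      Finset.sum_comm]
    congr 1
    · simp
    · refine Finset.sum_congr rfl fun s _ => ?_
      rw [integral_finsetSum _ fun k _ => hind s k]
      exact Finset.sum_congr rfl fun k _ => integral_indicator_one (hBm s k)
  refine hE.trans ?_
  -- Peeling produced only `log (1 + η)`; it is enlarged here to the form appearing in `L`.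
  have hlogle : Real.log (1 + η) ≤ Real.log ((1 + epsN lam) * (1 + η)) :=
    Real.log_le_log (by linarith [hη.1]) (by nlinarith [hη.1])
  have hγ1 : 0 < γ - 1 := sub_pos.mpr hγ
  have hstep : ∑ k, ∑ s ∈ Finset.Ico N T, μ.real (B s k) ≤
      ∑ k, (reachTime f (epsC lam u k) - 1) + 2 * M / Real.log (1 + η) *
        (1 / (γ - 1) ^ 2 + γ * Real.log ((1 + epsN lam) * (1 + η)) / (γ - 1) + 1) := by
    refine (Finset.sum_le_sum fun k _ => hBsum k).trans ?_
    rw [Finset.sum_add_distrib, Finset.sum_const, Finset.card_univ, Fintype.card_fin,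
      nsmul_eq_mul, ← mul_assoc, mul_div_assoc', mul_comm (M : ℝ) 2]
    gcongr
  rw [constL, hA]
  linarith

/-! ### Regret -/

theorem gap_nonneg {N : ℕ} (m : Fin N → ℝ) (i : Fin N) : 0 ≤ gap m i :=
  sub_nonneg.mpr (le_ciSup (Set.finite_range m).bddAbove i)

theorem regretUnc_eq_sum {M N : ℕ} {Ω : Type*} [MeasurableSpace Ω] {μ : Measure Ω}
    [IsProbabilityMeasure μ] (m : Fin N → ℝ) {arm : ℕ → Fin M → Ω → Fin N}
    (harm : ∀ s d, Measurable (arm (s + 1) d)) (T : ℕ) :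
    regretUnc μ m arm T = ∑ i, gap m i * ∫ ω, selCount (fun s j => arm s j ω) i T ∂μ := by
  have hint : ∀ i, Integrable (fun ω => gap m i * selCount (fun s j => arm s j ω) i T) μ :=
    fun i => (Integrable.of_bound (measurable_selCount harm i T).aestronglyMeasurable (T * M)
      (ae_of_all _ fun ω => by
        rw [Real.norm_of_nonneg (selCount_nonneg _ _ _)]
        exact selCount_le_mul _ _ _)).const_mul _
  have hpt : ∀ ω, ∑ t ∈ Finset.Icc 1 T, ∑ k, m (arm t k ω) = (M : ℝ) * T * (⨆ j, m j) -
      ∑ i, gap m i * selCount (fun s j => arm s j ω) i T := fun ω => by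
    rw [← regret_eq_sum_gap_mul_selCount m (fun s j => arm s j ω) T]
    ring
  rw [regretUnc]
  simp only [hpt]
  rw [integral_sub (integrable_const _) (integrable_finsetSum _ fun i _ => hint i),
    integral_finsetSum _ fun i _ => hint i]
  simp [integral_const_mul]

/-- The finite-time regret bound. -/
noncomputable def regretBound {M N : ℕ} (σ γ η : ℝ) (f : ℝ → ℝ) (lam : Fin M → ℝ)
    (u : Fin M → Fin M → ℝ) (m : Fin N → ℝ) (T : ℕ) : ℝ :=
  ∑ i with 0 < gap m i, 4 * σ ^ 2 * γ * Real.log T / (gap m i * gFun η) *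
    (1 + √(1 + gap m i ^ 2 * M * gFun η / (2 * γ * σ ^ 2) * (f T / Real.log T)))
  + ∑ i, constL γ η f (epsN lam) (epsC lam u) * gap m i

theorem sum_gap_mul_le_regretBound {M N : ℕ} {σ γ η : ℝ} {f : ℝ → ℝ} {lam : Fin M → ℝ}
    {u : Fin M → Fin M → ℝ} {m : Fin N → ℝ} {T : ℕ} {c : Fin N → ℝ}
    (hc : ∀ i, 0 < gap m i → c i ≤
      selThreshold M σ γ η f T (gap m i) + constL γ η f (epsN lam) (epsC lam u)) :
    ∑ i, gap m i * c i ≤ regretBound σ γ η f lam u m T := by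
  rw [regretBound, Finset.sum_filter, ← Finset.sum_add_distrib]
  refine Finset.sum_le_sum fun i _ => ?_
  split_ifs with hi
  · refine (mul_le_mul_of_nonneg_left (hc i hi) hi.le).trans (le_of_eq ?_)
    rw [mul_add, selThreshold, mul_comm (gap m i) (constL _ _ _ _ _), ← mul_assoc]
    congr 2
    field_simp
  · rw [le_antisymm (not_lt.mp hi) (gap_nonneg m i)]
    simp

theorem regretBound_eventually_le {M N : ℕ} {σ γ η : ℝ} {f : ℝ → ℝ}
    (hf : f =o[atTop] Real.log) (lam : Fin M → ℝ)
    (u : Fin M → Fin M → ℝ) (m : Fin N → ℝ) {δ : ℝ} (hδ : 0 < δ) :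
    ∀ᶠ T : ℕ in atTop, regretBound σ γ η f lam u m T ≤
      (∑ i with 0 < gap m i, 8 * σ ^ 2 * γ / (gap m i * gFun η) + δ) * Real.log T := by
  have hcast : Tendsto (fun T : ℕ => (T : ℝ)) atTop atTop := tendsto_natCast_atTop_atTop
  have hlog : Tendsto (fun T : ℕ => Real.log T) atTop atTop := Real.tendsto_log_atTop.comp hcast
  have hfl : Tendsto (fun T : ℕ => f T / Real.log T) atTop (𝓝 0) :=
    hf.tendsto_div_nhds_zero.comp hcast
  have hterm : ∀ a b : ℝ, Tendsto (fun T : ℕ => a * (1 + √(1 + b * (f T / Real.log T)))) atTop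
      (𝓝 (a * (1 + √(1 + b * 0)))) := fun a b =>
    (((hfl.const_mul b).const_add 1).sqrt.const_add 1).const_mul a
  -- After division by `log T` each square root tends to 1, turning 4 into 8, and the contribution
  -- of `L` vanishes.
  have hlim : Tendsto (fun T : ℕ => ∑ i with 0 < gap m i,
      4 * σ ^ 2 * γ / (gap m i * gFun η) *
        (1 + √(1 + gap m i ^ 2 * M * gFun η / (2 * γ * σ ^ 2) * (f T / Real.log T)))
      + (∑ i, constL γ η f (epsN lam) (epsC lam u) * gap m i) / Real.log T) atTop
      (𝓝 (∑ i with 0 < gap m i, 8 * σ ^ 2 * γ / (gap m i * gFun η))) := by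
    have h := (tendsto_finsetSum (Finset.univ.filter fun i => 0 < gap m i) fun i _ =>
      hterm (4 * σ ^ 2 * γ / (gap m i * gFun η))
        (gap m i ^ 2 * M * gFun η / (2 * γ * σ ^ 2))).add
      (hlog.const_div_atTop (∑ i, constL γ η f (epsN lam) (epsC lam u) * gap m i))
    convert h using 2
    rw [add_zero]
    refine Finset.sum_congr rfl fun i _ => ?_
    rw [mul_zero, add_zero, Real.sqrt_one]
    ring
  filter_upwards [hlim.eventually (gt_mem_nhds (lt_add_of_pos_right _ hδ)),
    hlog.eventually_gt_atTop 0] with T hT hT0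
  refine le_trans (le_of_eq ?_) (mul_le_mul_of_nonneg_right hT.le hT0.le)
  rw [regretBound, add_mul, Finset.sum_mul, div_mul_cancel₀ _ hT0.ne']
  congr 1
  refine Finset.sum_congr rfl fun i _ => ?_
  ring

end CoopUCB

theorem corollary1 {M N : ℕ} (G : SimpleGraph (Fin M)) [DecidableRel G.Adj] (hG : G.Connected)
    (κ : ℝ) (hκ : κ ∈ Set.Ioc (0 : ℝ) 1)
    (lam : Fin M → ℝ) (u : Fin M → Fin M → ℝ)
    (hlam : CoopUCB.IsOrderedEigenbasis (CoopUCB.consensusMatrix G κ) lam u)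
    (hlam_gt : ∀ p, -1 < lam p)
    (σ γ η : ℝ) (hσ : 0 < σ) (hγ : 1 < γ) (hη : η ∈ Set.Ioo (0 : ℝ) 4)
    (f : ℝ → ℝ) (hf_nonneg : ∀ t, 1 ≤ t → 0 ≤ f t) (hf_mono : MonotoneOn f (Set.Ici 1))
    (hf_sublog : f =o[atTop] Real.log)
    (hf_reach : ∀ k, ∃ t, 1 ≤ t ∧ CoopUCB.epsC lam u k ≤ f t)
    {Ω : Type*} [MeasurableSpace Ω] (μ : Measure Ω) [IsProbabilityMeasure μ]
    (p : Fin N → Measure ℝ) (hp : ∀ i, CoopUCB.IsSubGaussian (p i) σ)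
    (m : Fin N → ℝ) (hm : ∀ i, m i = ∫ x, x ∂(p i))
    (r : ℕ → Fin M → Fin N → Ω → ℝ) (hr : CoopUCB.IsRewardProcess μ p r)
    (arm : ℕ → Fin M → Ω → Fin N)
    (harm : CoopUCB.IsCoopUCB2 (CoopUCB.consensusMatrix G κ) σ γ η f r arm) :
    (∀ T : ℕ, 1 ≤ T →
      CoopUCB.regretUnc μ m arm T ≤
        ∑ i with 0 < CoopUCB.gap m i,
          4 * σ ^ 2 * γ * Real.log T / (CoopUCB.gap m i * CoopUCB.gFun η) *
            (1 + √(1 + CoopUCB.gap m i ^ 2 * M * CoopUCB.gFun η / (2 * γ * σ ^ 2)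
              * (f T / Real.log T)))
        + ∑ i, CoopUCB.constL γ η f (CoopUCB.epsN lam) (CoopUCB.epsC lam u) * CoopUCB.gap m i) ∧
    ((fun T : ℕ => CoopUCB.regretUnc μ m arm T) =O[atTop] fun T : ℕ => Real.log T) ∧
    (∀ δ : ℝ, 0 < δ → ∀ᶠ T : ℕ in atTop,
      CoopUCB.regretUnc μ m arm T ≤
        (∑ i with 0 < CoopUCB.gap m i,
          8 * σ ^ 2 * γ / (CoopUCB.gap m i * CoopUCB.gFun η) + δ) * Real.log T) := by
  have hP := CoopUCB.isMixing_consensusMatrix hG hκ hlam hlam_gt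
  have hreg := CoopUCB.regretUnc_eq_sum (μ := μ) m (harm.measurable hr)
  have hbound : ∀ T : ℕ,
      CoopUCB.regretUnc μ m arm T ≤ CoopUCB.regretBound σ γ η f lam u m T := fun T => by
    rw [hreg T]
    exact CoopUCB.sum_gap_mul_le_regretBound fun i hi =>
      CoopUCB.integral_selCount_le hP hσ hγ hη hf_nonneg hf_mono hf_reach hp hm hr harm hi T
  have hasymp : ∀ δ : ℝ, 0 < δ → ∀ᶠ T : ℕ in atTop,
      CoopUCB.regretUnc μ m arm T ≤
        (∑ i with 0 < CoopUCB.gap m i,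
          8 * σ ^ 2 * γ / (CoopUCB.gap m i * CoopUCB.gFun η) + δ) * Real.log T := fun δ hδ =>
    (CoopUCB.regretBound_eventually_le hf_sublog lam u m hδ).mono fun T hT => (hbound T).trans hT
  refine ⟨fun T _ => hbound T, ?_, hasymp⟩
  refine IsBigO.of_bound (∑ i with 0 < CoopUCB.gap m i,
    8 * σ ^ 2 * γ / (CoopUCB.gap m i * CoopUCB.gFun η) + 1) ?_
  filter_upwards [hasymp 1 one_pos] with T hT
  -- Nonnegativity of the regret turns the one-sided eventual bound into a bound on its norm.
  have h0 : 0 ≤ CoopUCB.regretUnc μ m arm T := by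
    rw [hreg T]
    exact Finset.sum_nonneg fun i _ => mul_nonneg (CoopUCB.gap_nonneg m i)
      (integral_nonneg fun ω => CoopUCB.selCount_nonneg _ _ _)
  rwa [Real.norm_of_nonneg h0, Real.norm_of_nonneg (Real.log_natCast_nonneg T)]
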